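/- Let $L=\mathbb{Q}(\alpha)$ be a cubic number field, where $\alpha$ is a root of $f(x)=x^3-ax+b$ with $a,b\in\mathbb{Z}$. Put $\Delta=4a^3-27b^2$ and $g=\gcd(a,b)$, and let $\mathcal{O}_L$ be the ring of integers of $L$. For a prime $p$ let $v_p$ be the $p$-adic valuation, with $v_p(0)=\infty$. A Hopf–Galois structure on $L/\mathbb{Q}$ is a finite-dimensional cocommutative $\mathbb{Q}$-Hopf algebra $H$ with a $\mathbb{Q}$-linear action on $L$ such that $L$ is an $H$-module algebra and the map $L\otimes_{\mathbb{Q}}H\to\mathrm{End}_{\mathbb{Q}}(L)$, $x\otimes h\mapsto(y\mapsto x(h\cdot y))$, is bijective (a cubic field has exactly one, up to isomorphism). The associated order is $\mathfrak{A}_H=\{h\in H : h\cdot x\in\mathcal{O}_L\text{ for all }x\in\mathcal{O}_L\}$. Consider the following conditions. * $(C_2)$ One of: $b\equiv1\pmod 2$; $a\equiv0\pmod 2$ and $b\equiv2\pmod 4$; $a\equiv3\pmod 4$ and $b\equiv0\pmod 4$; $a\equiv1\pmod 4$ and $b\equiv2\pmod 4$. * $(C_3)$ One of: $v_3(a)=0$;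 $v_3(a)\ge1$ and $v_3(b)=1$; $v_3(a)\ge1$, $a\not\equiv3\pmod 9$, $v_3(b)=0$ and $b^2\not\equiv a+1\pmod 9$; $a\equiv3\pmod 9$, $v_3(b)=0$ and $b^2\not\equiv4\pmod 9$. * $(C_{>3})$ For every prime $p>3$, one of: $v_p(a)=0$ and $v_p(b)\ge1$; $v_p(a)\ge1$ and $v_p(b)\le1$; $v_p(a)=v_p(b)=0$ and $v_p(\Delta)\le1$. Let $H$ be a Hopf–Galois structure on $L/\mathbb{Q}$. Then: 1. If $3\nmid a$ and $(C_2)$, $(C_{>3})$ hold, then $\mathcal{O}_L$ is a free $\mathfrak{A}_H$-module if and only if there are $x,y\in\mathbb{Z}$ such that $x^2+3\Delta y^2=12ag$ or $x^2+3\Delta y^2=-12ag$, $6a$ divides $9by+x$ or $9by-x$, and $3\nmid y$. 2. If $v_3(a)=v_3(b)=1$ and $(C_2)$, $(C_{>3})$ hold, then $\mathcal{O}_L$ is a free $\mathfrak{A}_H$-module if and only if there are $x,y\in\mathbb{Z}$ such that $x^2+3\Delta y^2=36ag$ or $x^2+3\Delta y^2=-36ag$, and $6a$ divides $9by+x$ or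 $9by-x$. 3. If $v_3(a)>v_3(b)$ and $(C_2)$, $(C_3)$, $(C_{>3})$ hold, then $\mathcal{O}_L$ is a free $\mathfrak{A}_H$-module if and only if there are $x,y\in\mathbb{Z}$ such that $x^2+3\Delta y^2=108ag$ or $x^2+3\Delta y^2=-108ag$, and $6a$ divides $9by+x$ or $9by-x$. Moreover, the conditions in each case are equivalent to $\mathcal{O}_L=\mathbb{Z}[\alpha]$: * if $3\nmid a$, then $\mathcal{O}_L=\mathbb{Z}[\alpha]$ if and only if $(C_2)$ and $(C_{>3})$ hold; * if $3\mid a$ and $v_3(a)\le v_3(b)$, then $\mathcal{O}_L=\mathbb{Z}[\alpha]$ if and only if $v_3(a)=v_3(b)=1$ and $(C_2)$, $(C_{>3})$ hold; * if $v_3(a)>v_3(b)$, then $\mathcal{O}_L=\mathbb{Z}[\alpha]$ if and only if $(C_2)$, $(C_3)$ and $(C_{>3})$ hold. -/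

import Mathlib

open scoped TensorProduct

section HopfGalois

variable (K H L : Type*) [Field K] [Ring H] [HopfAlgebra K H] [Field L] [Algebra K L]
  [Module H L] [IsScalarTower K H L]

/-- For fixed `x : L`, the `K`-linear map `H → L`, `h ↦ h • x`. -/
noncomputable def orbitMap (x : L) : H →ₗ[K] L :=
  (LinearMap.toSpanSingleton H L x).restrictScalars K

/-- The canonical map `L ⊗ H → End_K(L)`, `x ⊗ h ↦ (y ↦ x * (h • y))`. -/
noncomputable def hopfGaloisMap : L ⊗[K] H →ₗ[K] Module.End K L :=
  TensorProduct.lift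
    ((LinearMap.mul K (Module.End K L)).compl₁₂
      (Algebra.lmul K L).toLinearMap (Algebra.lsmul K K L : H →ₐ[K] Module.End K L).toLinearMap)

theorem hopfGaloisMap_tmul (x : L) (h : H) (y : L) :
    hopfGaloisMap K H L (x ⊗ₜ h) y = x * (h • y) := by
  simp [hopfGaloisMap]

/-- The `K`-linear action of the `K`-Hopf algebra `H` on `L` is a Hopf-Galois structure on `L / K`:
`H` is finite dimensional and cocommutative, `L` is an `H`-module algebra, and the canonical map
`L ⊗ H → End_K(L)` is bijective. -/
structure IsHopfGaloisStructure : Prop where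
  finite : Module.Finite K H
  cocomm : Coalgebra.IsCocomm K H
  /-- `h • 1 = ε(h) 1` -/
  smul_one : ∀ h : H, h • (1 : L) = algebraMap K L (Coalgebra.counit h)
  /-- `h • (x y) = ∑ (h₁ • x) (h₂ • y)`, where `∑ h₁ ⊗ h₂` is the comultiplication of `h` -/
  smul_mul : ∀ (h : H) (x y : L),
    h • (x * y) = LinearMap.mul' K L
      (TensorProduct.map (orbitMap K H L x) (orbitMap K H L y) (Coalgebra.comul h))
  bijective : Function.Bijective (hopfGaloisMap K H L)

end HopfGalois

section AssociatedOrder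

variable (H L : Type*) [Ring H] [Field L] [Module H L]

/-- The associated order `𝔄_H = {h ∈ H | h • 𝓞_L ⊆ 𝓞_L}` of the ring of integers `𝓞_L` of `L`
(the integral closure of `ℤ` in `L`). -/
def associatedOrder : Subring H where
  carrier := {h | ∀ x ∈ integralClosure ℤ L, h • x ∈ integralClosure ℤ L}
  mul_mem' {h k} hh hk x hx := by
    rw [mul_smul]
    exact hh _ (hk _ hx)
  one_mem' x hx := by rwa [one_smul]
  add_mem' {h k} hh hk x hx := by
    rw [add_smul]
    exact add_mem (hh _ hx) (hk _ hx)
  zero_mem' x _ := by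
    rw [zero_smul]
    exact zero_mem _
  neg_mem' {h} hh x hx := by
    rw [neg_smul]
    exact neg_mem (hh _ hx)

/-- The ring of integers `𝓞_L`, as a module over its associated order in `H`. -/
def integersModule : Submodule (associatedOrder H L) L where
  carrier := {x | x ∈ integralClosure ℤ L}
  add_mem' hx hy := (integralClosure ℤ L).add_mem hx hy
  zero_mem' := zero_mem (integralClosure ℤ L)
  smul_mem' h x hx := h.2 x hx

end AssociatedOrder

section Congruences

/-- The `p`-adic valuation of an integer, with `v_p(0) = ∞`. -/
noncomputable def vp (p : ℕ) (n : ℤ) : ℕ∞ := emultiplicity (p : ℤ) n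

/-- The discriminant `4 a ^ 3 - 27 b ^ 2` of `X ^ 3 - a X + b`. -/
def cubicDisc (a b : ℤ) : ℤ := 4 * a ^ 3 - 27 * b ^ 2

/-- The condition at the prime `2`. -/
def CondTwo (a b : ℤ) : Prop :=
  b ≡ 1 [ZMOD 2] ∨
  (a ≡ 0 [ZMOD 2] ∧ b ≡ 2 [ZMOD 4]) ∨
  (a ≡ 3 [ZMOD 4] ∧ b ≡ 0 [ZMOD 4]) ∨
  (a ≡ 1 [ZMOD 4] ∧ b ≡ 2 [ZMOD 4])

/-- The condition at the prime `3`. -/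
def CondThree (a b : ℤ) : Prop :=
  vp 3 a = 0 ∨
  (1 ≤ vp 3 a ∧ vp 3 b = 1) ∨
  (1 ≤ vp 3 a ∧ ¬ a ≡ 3 [ZMOD 9] ∧ vp 3 b = 0 ∧ ¬ b ^ 2 ≡ a + 1 [ZMOD 9]) ∨
  (a ≡ 3 [ZMOD 9] ∧ vp 3 b = 0 ∧ ¬ b ^ 2 ≡ 4 [ZMOD 9])

/-- The condition at the primes `p > 3`. -/
def CondLarge (a b : ℤ) : Prop :=
  ∀ p : ℕ, p.Prime → 3 < p →
    (vp p a = 0 ∧ 1 ≤ vp p b) ∨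
    (1 ≤ vp p a ∧ vp p b ≤ 1) ∨
    (vp p a = 0 ∧ vp p b = 0 ∧ vp p (cubicDisc a b) ≤ 1)

/-- `(x, y)` satisfies `x ^ 2 + 3 Δ y ^ 2 = ± m a g`, where `g = gcd(a, b)`, and
`6 a ∣ 9 b y + x` or `6 a ∣ 9 b y - x`. -/
def IsPellSolution (m a b x y : ℤ) : Prop :=
  (x ^ 2 + 3 * cubicDisc a b * y ^ 2 = m * a * (Int.gcd a b : ℤ) ∨
    x ^ 2 + 3 * cubicDisc a b * y ^ 2 = -(m * a * (Int.gcd a b : ℤ))) ∧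
  (6 * a ∣ 9 * b * y + x ∨ 6 * a ∣ 9 * b * y - x)

end Congruences

/-!
Let `f = X ^ 3 - a X + b`. The proof has two parts.

*The order `ℤ[α]`.* It fails to be maximal at a prime `p` exactly when `f` has a multiple root `r`
modulo `p` with `p ^ 2 ∣ f(r)` (`HasSingularResidue`, `CubicRoot.integralClosure_eq_adjoin_iff`). If
there is such an `r`, then `((α - r) ^ 2 + 3 r (α - r)) / p` is a new integral element. Conversely an
integral element of `p⁻¹ ℤ[α]` outside `ℤ[α]` can be reduced to one of the form `(α - s) / p` or
`(α ^ 2 + r α + r ^ 2 - a) / p`, and the coefficients of its minimal polynomial, which are integers,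
exhibit the singular residue. The conditions `CondTwo`, `CondThree`, `CondLarge` spell out that there
are no singular residues.

*The Hopf-Galois module structure.* Write the action of `h : H` in terms of the three complex
embeddings `φ k` of `L`, as `φ k (h • x) = ∑ i, c k i h * φ i x`. Since `L` is a module algebra, the
functionals `c k 0, c k 1, c k 2` are orthogonal idempotents for the convolution product, and by the
bijectivity of `L ⊗ H → End L` they form a basis of the functionals on `H`. So the rows of the matrix
`c` are permutations of one another, and multiplicativity of the action turns these
permutations into a group of order three. Hence the matrix is circulant (`exists_circulant_action`),
`h` commutes with the trace `t` and with `w = √Δ (σ - σ⁻¹)` for a 3-cycle `σ`, and `H` acts through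
the span of `1, t, w` (`HasActionCoords`), whatever the Hopf-Galois structure is.

When the ring of integers is `ℤ[α]`, the associated order has the `ℤ`-basis
`1, t / e, (e b (t - 3) + w) / N`, where `(e, N)` is `(1, 2 g)`, `(3, 6 g)`, `(3, 18 g)` in the three
cases. The ring of integers is free if and only if it has a generator `θ = u₀ + u₁ α + u₂ α ^ 2`, which
by a determinant means that `(3 u₀ + 2 a u₂) / e = ±1` and
`6 a u₁ ^ 2 - 18 b u₁ u₂ + 2 a ^ 2 u₂ ^ 2 = ± N` (`free_iff_exists_forms`). Completing the square with
`x = 6 a u₁ - 9 b u₂`, `y = u₂` turns the latter into the Pell-type equation. The linear condition can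
be solved for `u₀`, except that it forces `3 ∤ y` in the first case. The case `a = 0`, where completing
the square loses information, is treated separately: both sides of the equivalence then hold.
-/

/-! ### Cubic generators and the integrality of elements of a cubic field -/

theorem isIntegral_of_cubic {L : Type*} [Field L] {y : L} {c₂ c₁ c₀ : ℤ}
    (e : y ^ 3 + c₂ * y ^ 2 + c₁ * y + c₀ = 0) : IsIntegral ℤ y := by
  refine ⟨Polynomial.X ^ 3 + Polynomial.C c₂ * Polynomial.X ^ 2 +
    Polynomial.C c₁ * Polynomial.X + Polynomial.C c₀, by monicity!, ?_⟩
  rw [← Polynomial.aeval_def]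
  simpa using e

theorem isIntegral_intCast_mul {L : Type*} [Field L] {n : ℤ} {y : L} (hy : IsIntegral ℤ y) :
    IsIntegral ℤ ((n : L) * y) := by
  rw [← zsmul_eq_mul]; exact hy.smul n

/-- `n / p` is integral only if `p ∣ n`. -/
theorem dvd_of_isIntegral_div {L : Type*} [Field L] [CharZero L]
    {p : ℕ} (hp : p.Prime) {n : ℤ} {y : L} (hy : IsIntegral ℤ y)
    (e : (p : L) * y = n) : (p : ℤ) ∣ n := by
  have hpL : (p : L) ≠ 0 := by exact_mod_cast hp.ne_zero
  have hpQ : (p : ℚ) ≠ 0 := by exact_mod_cast hp.ne_zero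
  have hye : y = algebraMap ℚ L (n / p) := by
    rw [eq_ratCast]; push_cast; field_simp; linear_combination e
  rw [hye, isIntegral_algebraMap_iff (algebraMap ℚ L).injective] at hy
  obtain ⟨k, hk⟩ := IsIntegrallyClosed.isIntegral_iff.1 hy
  refine ⟨k, ?_⟩
  have : (k : ℚ) = n / p := by simpa using hk
  rw [eq_div_iff hpQ] at this
  have h2 : ((n : ℤ) : ℚ) = (p * k : ℤ) := by push_cast; linear_combination -this
  exact_mod_cast h2

/-- An integral element outside `ℚ` satisfies a monic rational cubic only if the latter has integral
coefficients: in a cubic field this cubic is the minimal polynomial. -/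
theorem exists_int_coeffs_of_isIntegral {L : Type*} [Field L] [CharZero L]
    (hdeg : Module.finrank ℚ L = 3) {y : L}
    (hy : IsIntegral ℤ y) (hnr : ∀ s : ℚ, y ≠ s) {c₂ c₁ c₀ : ℚ}
    (e : y ^ 3 + c₂ * y ^ 2 + c₁ * y + c₀ = 0) :
    (∃ n : ℤ, c₂ = n) ∧ (∃ n : ℤ, c₁ = n) ∧ ∃ n : ℤ, c₀ = n := by
  have hfin : FiniteDimensional ℚ L := FiniteDimensional.of_finrank_pos (by omega)
  have hyQ : IsIntegral ℚ y := Algebra.IsIntegral.isIntegral y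
  have hne1 : (minpoly ℚ y).natDegree ≠ 1 := fun h1 => by
    obtain ⟨s, hs⟩ := minpoly.natDegree_eq_one_iff.1 h1
    exact hnr s (by simpa using hs.symm)
  have hdvd : (minpoly ℚ y).natDegree ∣ 3 := hdeg ▸ minpoly.degree_dvd hyQ
  have h3 : (minpoly ℚ y).natDegree = 3 :=
    ((Nat.dvd_prime Nat.prime_three).1 hdvd).resolve_left hne1
  set P : Polynomial ℚ := Polynomial.X ^ 3 + Polynomial.C c₂ * Polynomial.X ^ 2 +
    Polynomial.C c₁ * Polynomial.X + Polynomial.C c₀ with hP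
  have hPm : P.Monic := by rw [hP]; monicity!
  have hPd : P.natDegree ≤ 3 := by rw [hP]; compute_degree
  have hPe : minpoly ℚ y = P := by
    refine (Polynomial.eq_of_monic_of_dvd_of_natDegree_le (minpoly.monic hyQ) hPm
      (minpoly.dvd ℚ y ?_) (by omega)).symm
    simpa [hP] using e
  have hmap := minpoly.isIntegrallyClosed_eq_field_fractions' ℚ hy
  have hc : ∀ i, P.coeff i = ((minpoly ℤ y).coeff i : ℤ) := fun i => by
    rw [← hPe, hmap, Polynomial.coeff_map]
    simp
  refine ⟨⟨(minpoly ℤ y).coeff 2, ?_⟩, ⟨(minpoly ℤ y).coeff 1, ?_⟩, ⟨(minpoly ℤ y).coeff 0, ?_⟩⟩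
  all_goals
    rw [← hc]
    simp [hP, Polynomial.coeff_X, Polynomial.coeff_C]

/-- `α` is a root of `X ^ 3 - a X + b` and `1, α, α ^ 2` is a `ℚ`-basis of `L`. -/
structure CubicRoot {L : Type*} [Field L] [CharZero L] (a b : ℤ) (α : L) : Prop where
  root : α ^ 3 = a * α - b
  indep : ∀ p q r : ℚ, (p : L) + q * α + r * α ^ 2 = 0 → p = 0 ∧ q = 0 ∧ r = 0
  span : ∀ v : L, ∃ p q r : ℚ, v = p + q * α + r * α ^ 2

theorem exists_basis_pow {L : Type*} [Field L] [NumberField L] (hdeg : Module.finrank ℚ L = 3)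
    (α : L) (hgen : IntermediateField.adjoin ℚ {α} = ⊤) :
    ∃ B : Module.Basis (Fin 3) ℚ L, ∀ i : Fin 3, B i = α ^ (i : ℕ) := by
  have hdegα : (minpoly ℚ α).natDegree = 3 := by
    rw [← IntermediateField.adjoin.finrank (Algebra.IsIntegral.isIntegral α), hgen,
      IntermediateField.finrank_top', hdeg]
  have hli := linearIndependent_pow (K := ℚ) α
  have hli' : LinearIndependent ℚ fun i : Fin 3 => α ^ (i : ℕ) := by
    rw [hdegα] at hli
    exact hli
  refine ⟨basisOfLinearIndependentOfCardEqFinrank hli' (by simp [hdeg]), fun i => ?_⟩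
  simp

theorem CubicRoot.of_adjoin_eq_top {L : Type*} [Field L] [NumberField L]
    (hdeg : Module.finrank ℚ L = 3) {a b : ℤ} {α : L}
    (hroot : α ^ 3 - (a : L) * α + (b : L) = 0)
    (hgen : IntermediateField.adjoin ℚ {α} = ⊤) : CubicRoot a b α := by
  obtain ⟨B, hB⟩ := exists_basis_pow hdeg α hgen
  refine ⟨by linear_combination hroot, fun p q r h => ?_, fun v => ?_⟩
  · have := Fintype.linearIndependent_iff.1 B.linearIndependent ![p, q, r] (by
      simp only [Fin.sum_univ_three, hB, Algebra.smul_def]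
      simpa using h)
    exact ⟨this 0, this 1, this 2⟩
  · refine ⟨B.repr v 0, B.repr v 1, B.repr v 2, ?_⟩
    conv_lhs => rw [← B.sum_repr v]
    simp [Fin.sum_univ_three, hB, Algebra.smul_def]

namespace CubicRoot

variable {L : Type*} [Field L] [CharZero L] {a b : ℤ} {α : L}

theorem ext_coords (h : CubicRoot a b α) {p q r p' q' r' : ℚ}
    (e : (p : L) + q * α + r * α ^ 2 = p' + q' * α + r' * α ^ 2) : p = p' ∧ q = q' ∧ r = r' := by
  have := h.indep (p - p') (q - q') (r - r') (by push_cast; linear_combination e)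
  exact ⟨sub_eq_zero.1 this.1, sub_eq_zero.1 this.2.1, sub_eq_zero.1 this.2.2⟩

theorem not_rat (h : CubicRoot a b α) {p q r : ℚ} (hqr : q ≠ 0 ∨ r ≠ 0) (s : ℚ) :
    (p : L) + q * α + r * α ^ 2 ≠ s := fun e => by
  have := h.ext_coords (p' := s) (q' := 0) (r' := 0) (by simpa using e)
  tauto

theorem sub_ne_zero (h : CubicRoot a b α) (r : ℤ) : α - r ≠ 0 := fun e => by
  have := h.indep (-r) 1 0 (by push_cast; linear_combination e)
  simp at this

/-- The cubic `X ^ 3 - a X + b` has no integral root. -/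
theorem eval_ne_zero (h : CubicRoot a b α) (r : ℤ) : r ^ 3 - a * r + b ≠ 0 := fun e => by
  have e' : (r : L) ^ 3 - a * r + b = 0 := by exact_mod_cast e
  have h2 : (α - r) * (α ^ 2 + r * α + (r ^ 2 - a)) = 0 := by
    linear_combination h.root - e'
  rcases mul_eq_zero.1 h2 with h3 | h3
  · exact h.sub_ne_zero r h3
  · have := h.indep (r ^ 2 - a) r 1 (by push_cast; linear_combination h3)
    simp at this

theorem b_ne_zero (h : CubicRoot a b α) : b ≠ 0 := by
  simpa using h.eval_ne_zero 0

theorem isIntegral (h : CubicRoot a b α) : IsIntegral ℤ α :=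
  isIntegral_of_cubic (c₂ := 0) (c₁ := -a) (c₀ := b) (by push_cast; linear_combination h.root)

theorem mem_adjoin_iff (h : CubicRoot a b α) {v : L} :
    v ∈ Algebra.adjoin ℤ {α} ↔ ∃ p q r : ℤ, v = p + q * α + r * α ^ 2 := by
  constructor
  · intro hv
    induction hv using Algebra.adjoin_induction with
    | mem x hx => exact ⟨0, 1, 0, by simpa using hx⟩
    | algebraMap n => exact ⟨n, 0, 0, by simp⟩
    | add x y _ _ hx hy =>
      obtain ⟨p, q, r, rfl⟩ := hx
      obtain ⟨p', q', r', rfl⟩ := hy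
      exact ⟨p + p', q + q', r + r', by push_cast; ring⟩
    | mul x y _ _ hx hy =>
      obtain ⟨p, q, r, rfl⟩ := hx
      obtain ⟨p', q', r', rfl⟩ := hy
      refine ⟨p * p' - b * (q * r' + r * q'), p * q' + q * p' + a * (q * r' + r * q') - b * r * r',
        p * r' + q * q' + r * p' + a * r * r', ?_⟩
      push_cast
      linear_combination (q * r' + r * q' + r * r' * α : L) * h.root
  · rintro ⟨p, q, r, rfl⟩
    have hα : α ∈ Algebra.adjoin ℤ {α} := Algebra.self_mem_adjoin_singleton ℤ α
    have hn : ∀ n : ℤ, (n : L) ∈ Algebra.adjoin ℤ {α} := fun n =>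
      (Algebra.adjoin ℤ {α}).algebraMap_mem n
    exact add_mem (add_mem (hn p) (mul_mem (hn q) hα)) (mul_mem (hn r) (pow_mem hα 2))

theorem adjoin_le (h : CubicRoot a b α) : Algebra.adjoin ℤ {α} ≤ integralClosure ℤ L :=
  Algebra.adjoin_le (by simpa [mem_integralClosure_iff] using h.isIntegral)

/-- The divisibilities that make the minimal polynomial of `(α - s) / n` integral. -/
theorem coeffs_of_isIntegral_linear (h : CubicRoot a b α) (hdeg : Module.finrank ℚ L = 3)
    {n : ℤ} (hn : n ≠ 0) {s : ℤ} {y : L} (hy : IsIntegral ℤ y) (e : (n : L) * y = α - s) :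
    n ∣ 3 * s ∧ n ^ 2 ∣ 3 * s ^ 2 - a ∧ n ^ 3 ∣ s ^ 3 - a * s + b := by
  have hnL : (n : L) ≠ 0 := by exact_mod_cast hn
  have hnQ : (n : ℚ) ≠ 0 := by exact_mod_cast hn
  have hα : α = n * y + s := by linear_combination -e
  obtain ⟨⟨k₂, h₂⟩, ⟨k₁, h₁⟩, ⟨k₀, h₀⟩⟩ := exists_int_coeffs_of_isIntegral hdeg hy
    (c₂ := 3 * s / n) (c₁ := (3 * s ^ 2 - a) / n ^ 2) (c₀ := (s ^ 3 - a * s + b) / n ^ 3)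
    (fun t ht => by
      refine h.not_rat (p := 0) (q := 1) (r := 0) (by simp) (n * t + s) ?_
      push_cast
      rw [← ht]
      linear_combination hα)
    (by
      have hr := h.root
      rw [hα] at hr
      push_cast
      field_simp
      linear_combination hr)
  refine ⟨⟨k₂, ?_⟩, ⟨k₁, ?_⟩, ⟨k₀, ?_⟩⟩
  · rw [div_eq_iff hnQ] at h₂
    have : ((3 * s : ℤ) : ℚ) = (n * k₂ : ℤ) := by push_cast; linear_combination h₂
    exact_mod_cast this
  · rw [div_eq_iff (pow_ne_zero _ hnQ)] at h₁
    have : ((3 * s ^ 2 - a : ℤ) : ℚ) = (n ^ 2 * k₁ : ℤ) := by push_cast; linear_combination h₁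
    exact_mod_cast this
  · rw [div_eq_iff (pow_ne_zero _ hnQ)] at h₀
    have : ((s ^ 3 - a * s + b : ℤ) : ℚ) = (n ^ 3 * k₀ : ℤ) := by push_cast; linear_combination h₀
    exact_mod_cast this

/-- If `(α ^ 2 + r α + r ^ 2 - a) / n = -f(r) / (n (α - r))` is integral, where `f = X ^ 3 - a X + b`,
then so are its trace `f'(r) / n` and its norm `f(r) ^ 2 / n ^ 3`. -/
theorem coeffs_of_isIntegral_quadratic (h : CubicRoot a b α) (hdeg : Module.finrank ℚ L = 3)
    {n : ℤ} (hn : n ≠ 0) {r : ℤ} {y : L} (hy : IsIntegral ℤ y)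
    (e : (n : L) * y = α ^ 2 + r * α + (r ^ 2 - a)) :
    n ∣ 3 * r ^ 2 - a ∧ n ^ 3 ∣ (r ^ 3 - a * r + b) ^ 2 := by
  have hnL : (n : L) ≠ 0 := by exact_mod_cast hn
  have hnQ : (n : ℚ) ≠ 0 := by exact_mod_cast hn
  have hγ := h.sub_ne_zero r
  have hy' : y = -(r ^ 3 - a * r + b) / (n * (α - r)) := by
    rw [eq_div_iff (mul_ne_zero hnL hγ)]
    linear_combination (α - r) * e + h.root
  obtain ⟨⟨k₂, h₂⟩, -, ⟨k₀, h₀⟩⟩ := exists_int_coeffs_of_isIntegral hdeg hy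
    (c₂ := -(3 * r ^ 2 - a) / n) (c₁ := 3 * r * (r ^ 3 - a * r + b) / n ^ 2)
    (c₀ := -(r ^ 3 - a * r + b) ^ 2 / n ^ 3)
    (fun t ht => by
      refine h.not_rat (p := r ^ 2 - a) (q := r) (r := 1) (by simp) (n * t) ?_
      push_cast
      rw [← ht]
      linear_combination -e)
    (by
      rw [hy']
      push_cast
      field_simp
      linear_combination (-(r ^ 3 - a * r + b) ^ 2 : L) * h.root)
  constructor
  · refine ⟨-k₂, ?_⟩
    rw [div_eq_iff hnQ] at h₂
    have : ((3 * r ^ 2 - a : ℤ) : ℚ) = (n * -k₂ : ℤ) := by push_cast; linear_combination -h₂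
    exact_mod_cast this
  · refine ⟨-k₀, ?_⟩
    rw [div_eq_iff (pow_ne_zero _ hnQ)] at h₀
    have : (((r ^ 3 - a * r + b) ^ 2 : ℤ) : ℚ) = (n ^ 3 * -k₀ : ℤ) := by
      push_cast; linear_combination -h₀
    exact_mod_cast this

end CubicRoot

/-- Some residue `r` is a multiple root of `f = X ^ 3 - a X + b` modulo `p` with `p ^ 2 ∣ f(r)`. In
other words, the maximal ideal `(p, α - r)` of the order `ℤ[α]` is singular. The second condition does
not depend on the choice of `r` modulo `p`, as `p` divides `f'(r)`. -/
def HasSingularResidue (a b : ℤ) (p : ℕ) : Prop :=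
  ∃ r : ℤ, (p : ℤ) ∣ 3 * r ^ 2 - a ∧ (p : ℤ) ^ 2 ∣ r ^ 3 - a * r + b

namespace CubicRoot

variable {L : Type*} [Field L] [CharZero L] {a b : ℤ} {α : L}

/-- At a singular residue `r` the order `ℤ[α]` is enlarged by `(γ ^ 2 + 3 r γ) / p`, where
`γ = α - r`. -/
theorem adjoin_ne_of_hasSingularResidue (h : CubicRoot a b α) {p : ℕ} (hp : p.Prime)
    (hs : HasSingularResidue a b p) : integralClosure ℤ L ≠ Algebra.adjoin ℤ {α} := by
  obtain ⟨r, ⟨c, hc⟩, ⟨d, hd⟩⟩ := hs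
  have hpL : (p : L) ≠ 0 := by exact_mod_cast hp.ne_zero
  have hc' : (3 * r ^ 2 - a : L) = p * c := by exact_mod_cast hc
  have hd' : (r ^ 3 - a * r + b : L) = p ^ 2 * d := by exact_mod_cast hd
  set γ : L := α - r with hγ
  have hγe : γ ^ 3 + 3 * r * γ ^ 2 + p * c * γ + p ^ 2 * d = 0 := by
    rw [hγ]
    linear_combination h.root - (α - r) * hc' - hd'
  set δ : L := (γ ^ 2 + 3 * r * γ) / p with hδ
  have hpδ : p * δ = γ ^ 2 + 3 * r * γ := by rw [hδ]; field_simp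
  have h1 : δ * γ = -c * γ - p * d := by
    apply mul_left_cancel₀ hpL
    linear_combination γ * hpδ + hγe
  have h2 : δ ^ 2 = -c * δ - d * γ - 3 * r * d := by
    apply mul_left_cancel₀ hpL
    linear_combination (δ + c) * hpδ + (γ + 3 * r) * h1
  have h3 : δ ^ 3 + (2 * c : ℤ) * δ ^ 2 + (c ^ 2 + 3 * r * d : ℤ) * δ +
      (3 * r * c * d - p * d ^ 2 : ℤ) = 0 := by
    push_cast
    linear_combination (δ + c) * h2 - d * h1
  have hint : IsIntegral ℤ δ := isIntegral_of_cubic h3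
  intro he
  obtain ⟨u, v, w, hw⟩ := h.mem_adjoin_iff.1 (he ▸ hint : δ ∈ Algebra.adjoin ℤ {α})
  have hpQ : (p : ℚ) ≠ 0 := by exact_mod_cast hp.ne_zero
  have := (h.ext_coords (p := p * u) (q := p * v) (r := p * w)
    (p' := -2 * r ^ 2) (q' := r) (r' := 1) (by
      push_cast
      have : (p : L) * δ = α ^ 2 + r * α - 2 * r ^ 2 := by rw [hpδ, hγ]; ring
      rw [hw] at this
      linear_combination this)).2.2
  have hdvd : (p : ℤ) * w = 1 := by exact_mod_cast this
  have := Int.natAbs_dvd_natAbs.2 ⟨w, hdvd.symm⟩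
  exact hp.one_lt.ne' (by simpa using this)

theorem hasSingularResidue_of_linear (h : CubicRoot a b α) (hdeg : Module.finrank ℚ L = 3)
    {p : ℕ} (hp : p.Prime) {s : ℤ} {y : L} (hy : IsIntegral ℤ y) (e : (p : L) * y = α - s) :
    HasSingularResidue a b p := by
  obtain ⟨-, h1, h0⟩ := h.coeffs_of_isIntegral_linear hdeg (n := p)
    (by exact_mod_cast hp.ne_zero) hy (by simpa using e)
  exact ⟨s, (dvd_pow_self _ two_ne_zero).trans h1, (pow_dvd_pow _ (by norm_num)).trans h0⟩

theorem hasSingularResidue_of_quadratic (h : CubicRoot a b α) (hdeg : Module.finrank ℚ L = 3)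
    {p : ℕ} (hp : p.Prime) {r : ℤ} {y : L} (hy : IsIntegral ℤ y)
    (e : (p : L) * y = α ^ 2 + r * α + (r ^ 2 - a)) : HasSingularResidue a b p := by
  obtain ⟨h1, h0⟩ := h.coeffs_of_isIntegral_quadratic hdeg (n := p)
    (by exact_mod_cast hp.ne_zero) hy (by simpa using e)
  refine ⟨r, h1, ?_⟩
  set m := r ^ 3 - a * r + b
  have hpp : Prime (p : ℤ) := Nat.prime_iff_prime_int.1 hp
  obtain ⟨k, hk⟩ : (p : ℤ) ∣ m := hpp.dvd_of_dvd_pow ((dvd_pow_self _ three_ne_zero).trans h0)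
  have hk2 : (p : ℤ) ∣ k ^ 2 := by
    obtain ⟨j, hj⟩ := h0
    refine ⟨j, mul_left_cancel₀ (pow_ne_zero 2 hpp.ne_zero) ?_⟩
    rw [hk] at hj
    linear_combination hj
  obtain ⟨l, hl⟩ := hpp.dvd_of_dvd_pow hk2
  exact ⟨l, by rw [hk, hl]; ring⟩

/-- An integral `(u + v α) / p` with `p ∤ v` could be scaled to some `(α - s) / p`, which would make `s`
a singular residue. -/
theorem dvd_coords_of_isIntegral_linear (h : CubicRoot a b α) (hdeg : Module.finrank ℚ L = 3)
    {p : ℕ} (hp : p.Prime) {u v : ℤ} {y : L} (hy : IsIntegral ℤ y) (e : (p : L) * y = u + v * α)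
    (hns : ¬ HasSingularResidue a b p) : (p : ℤ) ∣ u ∧ (p : ℤ) ∣ v := by
  have hv : (p : ℤ) ∣ v := by
    by_contra hv
    have hcop := ((Nat.prime_iff_prime_int.1 hp).coprime_iff_not_dvd.2 hv)
    obtain ⟨m, n, hmn⟩ := hcop
    have hmn' : (m : L) * p + n * v = 1 := by exact_mod_cast hmn
    refine hns (h.hasSingularResidue_of_linear hdeg hp (s := -(n * u)) (y := n * y + m * α)
      ((isIntegral_intCast_mul hy).add (isIntegral_intCast_mul h.isIntegral)) ?_)
    push_cast
    linear_combination n * e + α * hmn'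
  obtain ⟨k, rfl⟩ := hv
  refine ⟨dvd_of_isIntegral_div hp (y := y - k * α)
    (hy.sub (isIntegral_intCast_mul h.isIntegral)) ?_, dvd_mul_right _ _⟩
  push_cast at e
  linear_combination e

/-- If `p` has no singular residue, then `p` does not divide the index of `ℤ[α]` in the ring of
integers. The polynomials `g` with `g(α) / p` integral form an ideal modulo `p`; a nonzero proper ideal
would contain a linear polynomial, or a quadratic one that divides `X ^ 3 - a X + b` modulo `p`. -/
theorem dvd_coords_of_isIntegral (h : CubicRoot a b α) (hdeg : Module.finrank ℚ L = 3)
    {p : ℕ} (hp : p.Prime) (hns : ¬ HasSingularResidue a b p) {u v w : ℤ} {y : L}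
    (hy : IsIntegral ℤ y) (e : (p : L) * y = u + v * α + w * α ^ 2) :
    (p : ℤ) ∣ u ∧ (p : ℤ) ∣ v ∧ (p : ℤ) ∣ w := by
  have hw : (p : ℤ) ∣ w := by
    by_contra hw
    obtain ⟨m, n, hmn⟩ := (Nat.prime_iff_prime_int.1 hp).coprime_iff_not_dvd.2 hw
    have hmn' : (m : L) * p + n * w = 1 := by exact_mod_cast hmn
    -- scale the leading coefficient to `1`
    obtain ⟨u', hu'⟩ : ∃ u', u' = n * u := ⟨_, rfl⟩
    obtain ⟨v', hv'⟩ : ∃ v', v' = n * v := ⟨_, rfl⟩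
    obtain ⟨z, hz, ez⟩ : ∃ z : L, IsIntegral ℤ z ∧ (p : L) * z = u' + v' * α + α ^ 2 :=
      ⟨n * y + m * α ^ 2, (isIntegral_intCast_mul hy).add
        (isIntegral_intCast_mul (h.isIntegral.pow 2)), by
          rw [hu', hv']; push_cast; linear_combination n * e + α ^ 2 * hmn'⟩
    -- the remainder of `X ^ 3 - a X + b` modulo the quadratic polynomial
    obtain ⟨-, k, hk⟩ := h.dvd_coords_of_isIntegral_linear hdeg hp (y := (α - v') * z)
      (u := -b - u' * v') (v := u' + a - v' ^ 2)
      ((h.isIntegral.sub (isIntegral_algebraMap (x := v'))).mul hz)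
      (by push_cast; linear_combination (α - v') * ez + h.root) hns
    refine hns (h.hasSingularResidue_of_quadratic hdeg hp (r := v') (y := z - k)
      (hz.sub (isIntegral_algebraMap (x := k))) ?_)
    have hk' : (u' + a - v' ^ 2 : L) = p * k := by exact_mod_cast hk
    linear_combination ez + hk'
  obtain ⟨k, rfl⟩ := hw
  have := h.dvd_coords_of_isIntegral_linear hdeg hp (u := u) (v := v) (y := y - k * α ^ 2)
    (hy.sub (isIntegral_intCast_mul (h.isIntegral.pow 2)))
    (by push_cast at e; linear_combination e) hns
  exact ⟨this.1, this.2, dvd_mul_right _ _⟩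

theorem isIntegral_mem_adjoin (h : CubicRoot a b α) (hdeg : Module.finrank ℚ L = 3)
    (hns : ∀ p : ℕ, p.Prime → ¬ HasSingularResidue a b p) (n : ℕ) (hn : n ≠ 0) :
    ∀ {y : L}, IsIntegral ℤ y → (∃ u v w : ℤ, (n : L) * y = u + v * α + w * α ^ 2) →
      y ∈ Algebra.adjoin ℤ {α} := by
  induction n using Nat.recOnMul with
  | zero => exact absurd rfl hn
  | one =>
    rintro y hy ⟨u, v, w, e⟩
    exact h.mem_adjoin_iff.2 ⟨u, v, w, by simpa using e⟩
  | prime p hp =>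
    rintro y hy ⟨u, v, w, e⟩
    obtain ⟨⟨u, rfl⟩, ⟨v, rfl⟩, ⟨w, rfl⟩⟩ := h.dvd_coords_of_isIntegral hdeg hp (hns p hp) hy e
    have hpL : (p : L) ≠ 0 := by exact_mod_cast hp.ne_zero
    refine h.mem_adjoin_iff.2 ⟨u, v, w, mul_left_cancel₀ hpL ?_⟩
    push_cast at e
    linear_combination e
  | mul m n hm hn' =>
    rintro y hy ⟨u, v, w, e⟩
    have hm0 : m ≠ 0 := fun h0 => hn (by simp [h0])
    have hn0 : n ≠ 0 := fun h0 => hn (by simp [h0])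
    have hny : IsIntegral ℤ ((n : L) * y) := by
      exact_mod_cast isIntegral_intCast_mul (n := n) hy
    have := hm hm0 hny ⟨u, v, w, by push_cast at e; linear_combination e⟩
    exact hn' hn0 hy (h.mem_adjoin_iff.1 this)

theorem integralClosure_eq_adjoin_iff (h : CubicRoot a b α) (hdeg : Module.finrank ℚ L = 3) :
    integralClosure ℤ L = Algebra.adjoin ℤ {α} ↔
      ∀ p : ℕ, p.Prime → ¬ HasSingularResidue a b p := by
  refine ⟨fun e p hp hs => h.adjoin_ne_of_hasSingularResidue hp hs e, fun hns => ?_⟩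
  refine le_antisymm (fun y hy => ?_) h.adjoin_le
  obtain ⟨u, v, w, e⟩ := h.span y
  refine h.isIntegral_mem_adjoin hdeg hns (u.den * v.den * w.den) (by simp) hy
    ⟨u.num * v.den * w.den, u.den * v.num * w.den, u.den * v.den * w.num, ?_⟩
  have hu := Rat.mul_den_eq_num u
  have hv := Rat.mul_den_eq_num v
  have hw := Rat.mul_den_eq_num w
  have hu' : (u : L) * u.den = u.num := by exact_mod_cast hu
  have hv' : (v : L) * v.den = v.num := by exact_mod_cast hv
  have hw' : (w : L) * w.den = w.num := by exact_mod_cast hw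
  push_cast
  rw [e, ← hu', ← hv', ← hw']
  ring

end CubicRoot

/-! ### The congruence conditions at the primes -/

theorem vp_eq_zero_iff {p : ℕ} {n : ℤ} : vp p n = 0 ↔ ¬ (p : ℤ) ∣ n := emultiplicity_eq_zero

theorem one_le_vp_iff {p : ℕ} {n : ℤ} : 1 ≤ vp p n ↔ (p : ℤ) ∣ n := by
  have := pow_dvd_iff_le_emultiplicity (a := (p : ℤ)) (b := n) (k := 1)
  rw [pow_one] at this
  exact this.symm

theorem vp_le_one_iff {p : ℕ} {n : ℤ} : vp p n ≤ 1 ↔ ¬ (p : ℤ) ^ 2 ∣ n := by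
  rw [← emultiplicity_lt_iff_not_dvd]
  exact (ENat.lt_natCast_add_one_iff (n := 1)).symm

theorem vp_eq_one_iff {p : ℕ} {n : ℤ} : vp p n = 1 ↔ (p : ℤ) ∣ n ∧ ¬ (p : ℤ) ^ 2 ∣ n := by
  rw [← one_le_vp_iff, ← vp_le_one_iff, and_comm, le_antisymm_iff]

/-- The condition `2 ∣ f'(r)` is read off from `2 f'(r)` in `ZMod 4`, which leaves a finite check. -/
theorem hasSingularResidue_two_iff {a b : ℤ} : HasSingularResidue a b 2 ↔ ¬ CondTwo a b := by
  have key : ∀ A B : ZMod 4, (∃ r : ZMod 4, 2 * (3 * r ^ 2 - A) = 0 ∧ r ^ 3 - A * r + B = 0) ↔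
      ¬ (2 * B = 2 ∨ (2 * A = 0 ∧ B = 2) ∨ (A = 3 ∧ B = 0) ∨ (A = 1 ∧ B = 2)) := by decide
  have h4 : ∀ x : ℤ, (x : ZMod 4) = 0 ↔ 4 ∣ x := fun x => ZMod.intCast_zmod_eq_zero_iff_dvd x 4
  have heq : ∀ x y : ℤ, (x : ZMod 4) = y ↔ x ≡ y [ZMOD 4] := fun x y =>
    ZMod.intCast_eq_intCast_iff x y 4
  have h1 : CondTwo a b ↔ (2 * (b : ZMod 4) = 2 ∨ (2 * (a : ZMod 4) = 0 ∧ (b : ZMod 4) = 2) ∨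
      ((a : ZMod 4) = 3 ∧ (b : ZMod 4) = 0) ∨ ((a : ZMod 4) = 1 ∧ (b : ZMod 4) = 2)) := by
    have e1 := heq (2 * b) 2
    have e2 := heq (2 * a) 0
    have e3 := heq b 2
    have e4 := heq a 3
    have e5 := heq b 0
    have e6 := heq a 1
    push_cast at e1 e2 e3 e4 e5 e6
    rw [e1, e2, e3, e4, e5, e6]
    unfold CondTwo Int.ModEq
    omega
  rw [h1, ← key]
  constructor
  · rintro ⟨r, hr1, hr2⟩
    refine ⟨r, ?_, ?_⟩
    · have := (h4 (2 * (3 * r ^ 2 - a))).2 (by push_cast at hr1; omega)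
      exact_mod_cast this
    · have := (h4 (r ^ 3 - a * r + b)).2 (by push_cast at hr2; omega)
      exact_mod_cast this
  · rintro ⟨r, hr1, hr2⟩
    obtain ⟨r, rfl⟩ := ZMod.intCast_surjective r
    have e1 := (h4 (2 * (3 * r ^ 2 - a))).1 (by push_cast; exact hr1)
    have e2 := (h4 (r ^ 3 - a * r + b)).1 (by push_cast; exact hr2)
    exact ⟨r, by push_cast; omega, by push_cast; omega⟩

theorem not_hasSingularResidue_three {a b : ℤ} (ha : ¬ (3 : ℤ) ∣ a) :
    ¬ HasSingularResidue a b 3 := by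
  rintro ⟨r, hr, -⟩
  push_cast at hr
  omega

/-- If `3 ∣ a`, then `-b` is the triple root of `X ^ 3 - a X + b` modulo `3`, and the value of the
polynomial there is `-b (b ^ 2 - a - 1)`. -/
theorem hasSingularResidue_three_iff {a b : ℤ} (ha : (3 : ℤ) ∣ a) :
    HasSingularResidue a b 3 ↔ 9 ∣ b * (b ^ 2 - a - 1) := by
  have key : ∀ A B : ZMod 9, 3 * A = 0 →
    ((∃ r : ZMod 9, r ^ 3 - A * r + B = 0) ↔ B * (B ^ 2 - A - 1) = 0) := by decide +kernel
  have h9 : ∀ x : ℤ, (x : ZMod 9) = 0 ↔ 9 ∣ x := fun x => ZMod.intCast_zmod_eq_zero_iff_dvd x 9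
  have ha' : 3 * (a : ZMod 9) = 0 := by
    have := (h9 (3 * a)).2 (by omega)
    exact_mod_cast this
  rw [← h9]
  push_cast
  rw [← key _ _ ha']
  constructor
  · rintro ⟨r, -, hr⟩
    refine ⟨r, ?_⟩
    have := (h9 (r ^ 3 - a * r + b)).2 (by push_cast at hr; omega)
    exact_mod_cast this
  · rintro ⟨r, hr⟩
    obtain ⟨r, rfl⟩ := ZMod.intCast_surjective r
    have e2 := (h9 (r ^ 3 - a * r + b)).1 (by push_cast; exact hr)
    exact ⟨r, by push_cast; omega, by push_cast; omega⟩

theorem condThree_iff {a b : ℤ} (ha : (3 : ℤ) ∣ a) :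
    CondThree a b ↔ ¬ HasSingularResidue a b 3 := by
  have key : ∀ A B : ZMod 9, 3 * A = 0 →
    (((3 * B = 0 ∧ B ≠ 0) ∨ (A ≠ 3 ∧ 3 * B ≠ 0 ∧ B ^ 2 ≠ A + 1) ∨ (A = 3 ∧ 3 * B ≠ 0 ∧ B ^ 2 ≠ 4))
      ↔ B * (B ^ 2 - A - 1) ≠ 0) := by decide +kernel
  have h9 : ∀ x : ℤ, (x : ZMod 9) = 0 ↔ 9 ∣ x := fun x => ZMod.intCast_zmod_eq_zero_iff_dvd x 9
  have heq : ∀ x y : ℤ, (x : ZMod 9) = y ↔ x ≡ y [ZMOD 9] := fun x y =>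
    ZMod.intCast_eq_intCast_iff x y 9
  have ha' : 3 * (a : ZMod 9) = 0 := by
    have := (h9 (3 * a)).2 (by omega)
    exact_mod_cast this
  have e0 := h9 (b * (b ^ 2 - a - 1))
  have e1 := h9 (3 * b)
  have e2 := h9 b
  have e3 := heq a 3
  have e4 := heq (b ^ 2) (a + 1)
  have e5 := heq (b ^ 2) 4
  push_cast at e0 e1 e2 e3 e4 e5
  have h3b : 9 ∣ 3 * b ↔ 3 ∣ b := by omega
  rw [hasSingularResidue_three_iff ha, ← e0, ← ne_eq, ← key _ _ ha']
  simp only [ne_eq, e1, e2, e3, e4, e5, CondThree, vp_eq_zero_iff, vp_eq_one_iff, one_le_vp_iff, h3b]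
  norm_num [ha]

theorem hasSingularResidue_iff_of_three_lt {a b : ℤ} {p : ℕ} (hp : p.Prime) (h3 : 3 < p) :
    HasSingularResidue a b p ↔ ¬ ((vp p a = 0 ∧ 1 ≤ vp p b) ∨ (1 ≤ vp p a ∧ vp p b ≤ 1) ∨
      (vp p a = 0 ∧ vp p b = 0 ∧ vp p (cubicDisc a b) ≤ 1)) := by
  rw [vp_eq_zero_iff, vp_eq_zero_iff, vp_le_one_iff, vp_le_one_iff, one_le_vp_iff, one_le_vp_iff]
  have hpp : Prime (p : ℤ) := Nat.prime_iff_prime_int.1 hp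
  have hsmall : ∀ n : ℕ, 0 < n → n < p → ¬ (p : ℤ) ∣ n := fun n h0 hn hd =>
    absurd (Nat.le_of_dvd h0 (Int.natCast_dvd_natCast.1 hd)) (by omega)
  have hp2 : ¬ (p : ℤ) ∣ 2 := hsmall 2 (by norm_num) (by omega)
  have hp3 : ¬ (p : ℤ) ∣ 3 := hsmall 3 (by norm_num) (by omega)
  constructor
  · rintro ⟨r, hD, hF⟩ (⟨ha, hb⟩ | ⟨ha, hb⟩ | ⟨-, -, hΔ⟩)
    · have hr : ¬ (p : ℤ) ∣ r := fun hr => ha <| by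
        have h := dvd_sub ((hr.mul_left (3 * r))) hD
        have e : 3 * r * r - (3 * r ^ 2 - a) = a := by ring
        rwa [e] at h
      have h1 : (p : ℤ) ∣ r * (r ^ 2 - a) := by
        have h := dvd_sub ((dvd_pow_self _ two_ne_zero).trans hF) hb
        have e : r ^ 3 - a * r + b - b = r * (r ^ 2 - a) := by ring
        rwa [e] at h
      have h2 := (hpp.dvd_or_dvd h1).resolve_left hr
      have h4 : (p : ℤ) ∣ 2 * r ^ 2 := by
        have h := dvd_sub hD h2
        have e : 3 * r ^ 2 - a - (r ^ 2 - a) = 2 * r ^ 2 := by ring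
        rwa [e] at h
      exact hr (hpp.dvd_of_dvd_pow ((hpp.dvd_or_dvd h4).resolve_left hp2))
    · have h1 : (p : ℤ) ∣ 3 * r ^ 2 := by simpa using dvd_add hD ha
      obtain ⟨k, rfl⟩ := hpp.dvd_of_dvd_pow ((hpp.dvd_or_dvd h1).resolve_left hp3)
      obtain ⟨l, rfl⟩ := ha
      obtain ⟨m, hm⟩ := hF
      exact hb ⟨m - p * k ^ 3 + l * k, by linear_combination hm⟩
    · obtain ⟨d, hd⟩ := hD
      obtain ⟨m, hm⟩ := hF
      -- the discriminant lies in the ideal generated by `f(r)` and `f'(r) ^ 2`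
      have ha : a = 3 * r ^ 2 - p * d := by linear_combination -hd
      have hb : b = p ^ 2 * m + 2 * r ^ 3 - p * d * r := by
        linear_combination hm + r * ha
      refine hΔ ⟨9 * r ^ 2 * d ^ 2 - 4 * p * d ^ 3 - 27 * m * (p ^ 2 * m + 4 * r ^ 3 - 2 * p * d * r), ?_⟩
      rw [cubicDisc, ha, hb]
      ring
  · intro hcond
    by_cases ha : (p : ℤ) ∣ a
    · have hb : (p : ℤ) ^ 2 ∣ b := by tauto
      exact ⟨0, by simpa using ha, by simpa using hb⟩
    · have hΔ : (p : ℤ) ^ 2 ∣ cubicDisc a b := by tauto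
      -- the double root modulo `p` is `3 b / (2 a)`
      have hcop2 : IsCoprime ((p : ℤ) ^ 2) 2 := (hpp.coprime_iff_not_dvd.2 hp2).pow_left
      have hcopa : IsCoprime ((p : ℤ) ^ 2) a := (hpp.coprime_iff_not_dvd.2 ha).pow_left
      have hcop : IsCoprime ((p : ℤ) ^ 2) (2 * a) := hcop2.mul_right hcopa
      obtain ⟨m, n, hmn⟩ := hcop
      obtain ⟨d, hd⟩ := hΔ
      rw [cubicDisc] at hd
      have hr : 2 * a * (3 * b * n) = 3 * b - p ^ 2 * (3 * b * m) := by linear_combination 3 * b * hmn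
      obtain ⟨r, hrr⟩ : ∃ r, r = 3 * b * n := ⟨_, rfl⟩
      obtain ⟨s, hss⟩ : ∃ s, s = 3 * b * m := ⟨_, rfl⟩
      rw [← hrr, ← hss] at hr
      refine ⟨r, (dvd_pow_self _ two_ne_zero).trans
        ((hcop2.mul_right hcopa).pow_right.dvd_of_dvd_mul_left (y := (2 * a) ^ 2)
          ⟨-d - 18 * b * s + 3 * p ^ 2 * s ^ 2, ?_⟩),
        ((hcop2.mul_right hcopa).pow_right.dvd_of_dvd_mul_left (y := (2 * a) ^ 3)
          ⟨-b * d + 4 * a ^ 3 * s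
            - s * ((3 * b) ^ 2 + 3 * b * (2 * a * r) + (2 * a * r) ^ 2), ?_⟩)⟩
      · linear_combination 3 * (2 * a * r + (3 * b - p ^ 2 * s)) * hr - hd
      · linear_combination -b * hd + (-4 * a ^ 3
            + ((3 * b) ^ 2 + 3 * b * (2 * a * r) + (2 * a * r) ^ 2)) * hr

theorem condLarge_iff {a b : ℤ} :
    CondLarge a b ↔ ∀ p : ℕ, p.Prime → 3 < p → ¬ HasSingularResidue a b p := by
  refine forall_congr' fun p => forall_congr' fun hp => forall_congr' fun h3 => ?_
  rw [hasSingularResidue_iff_of_three_lt hp h3, not_not]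

theorem forall_not_hasSingularResidue_iff {a b : ℤ} :
    (∀ p : ℕ, p.Prime → ¬ HasSingularResidue a b p) ↔
      CondTwo a b ∧ ¬ HasSingularResidue a b 3 ∧ CondLarge a b := by
  have h2 : CondTwo a b ↔ ¬ HasSingularResidue a b 2 := by
    rw [hasSingularResidue_two_iff, not_not]
  rw [condLarge_iff, h2]
  refine ⟨fun h => ⟨h 2 Nat.prime_two, h 3 Nat.prime_three, fun p hp _ => h p hp⟩, ?_⟩
  rintro ⟨h2, h3, hl⟩ p hp
  rcases lt_or_ge 3 p with h | h
  · exact hl p hp h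
  · have := hp.two_le
    interval_cases p
    exacts [h2, h3]

theorem integralClosure_eq_adjoin_iff_of_not_dvd {L : Type*} [Field L] [CharZero L] {a b : ℤ} {α : L}
    (h : CubicRoot a b α) (hdeg : Module.finrank ℚ L = 3) (ha : ¬ (3 : ℤ) ∣ a) :
    CondTwo a b ∧ CondLarge a b ↔ integralClosure ℤ L = Algebra.adjoin ℤ {α} := by
  rw [h.integralClosure_eq_adjoin_iff hdeg, forall_not_hasSingularResidue_iff]
  have := not_hasSingularResidue_three (b := b) ha
  tauto

theorem integralClosure_eq_adjoin_iff_of_vp_le {L : Type*} [Field L] [CharZero L] {a b : ℤ} {α : L}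
    (h : CubicRoot a b α) (hdeg : Module.finrank ℚ L = 3) (ha : (3 : ℤ) ∣ a)
    (hab : vp 3 a ≤ vp 3 b) :
    vp 3 a = 1 ∧ vp 3 b = 1 ∧ CondTwo a b ∧ CondLarge a b ↔
      integralClosure ℤ L = Algebra.adjoin ℤ {α} := by
  rw [h.integralClosure_eq_adjoin_iff hdeg, forall_not_hasSingularResidue_iff]
  have hva : 1 ≤ vp 3 a := one_le_vp_iff.2 ha
  have hb : (3 : ℤ) ∣ b := by exact_mod_cast one_le_vp_iff.1 (hva.trans hab)
  have h1 : (vp 3 a = 1 ∧ vp 3 b = 1) ↔ ¬ (9 : ℤ) ∣ b := by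
    have e : vp 3 b = 1 ↔ ¬ (9 : ℤ) ∣ b := by
      rw [vp_eq_one_iff]; norm_num [hb]
    rw [e]
    refine and_iff_right_of_imp fun h9 => ?_
    exact le_antisymm (hab.trans (e.2 h9).le) hva
  have h2 : HasSingularResidue a b 3 ↔ (9 : ℤ) ∣ b := by
    rw [hasSingularResidue_three_iff ha]
    have hcop : IsCoprime (9 : ℤ) (b ^ 2 - a - 1) := by
      obtain ⟨c, rfl⟩ := ha
      obtain ⟨d, rfl⟩ := hb
      have : IsCoprime (3 : ℤ) ((3 * d) ^ 2 - 3 * c - 1) := ⟨3 * d ^ 2 - c, -1, by ring⟩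
      exact this.pow_left (m := 2)
    exact ⟨hcop.dvd_of_dvd_mul_right, fun h => h.mul_right _⟩
  rw [h2]
  tauto

theorem integralClosure_eq_adjoin_iff_of_vp_lt {L : Type*} [Field L] [CharZero L] {a b : ℤ} {α : L}
    (h : CubicRoot a b α) (hdeg : Module.finrank ℚ L = 3) (hab : vp 3 b < vp 3 a) :
    CondTwo a b ∧ CondThree a b ∧ CondLarge a b ↔
      integralClosure ℤ L = Algebra.adjoin ℤ {α} := by
  have ha : (3 : ℤ) ∣ a := by
    exact_mod_cast one_le_vp_iff.1 (Order.one_le_iff_pos.2 (bot_le.trans_lt hab))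
  rw [h.integralClosure_eq_adjoin_iff hdeg, forall_not_hasSingularResidue_iff, condThree_iff ha]

/-! ### The action of a Hopf-Galois structure in terms of the complex embeddings -/

theorem exists_fin_embeddings {L : Type*} [Field L] [CharZero L]
    (hdeg : Module.finrank ℚ L = 3) :
    ∃ φ : Fin 3 → (L →ₐ[ℚ] ℂ), Function.Injective φ := by
  have hfin : FiniteDimensional ℚ L := FiniteDimensional.of_finrank_pos (by omega)
  have hcard : Fintype.card (L →ₐ[ℚ] ℂ) = 3 := by
    rw [AlgHom.card, hdeg]
  exact ⟨(Fintype.equivFinOfCardEq hcard).symm, (Fintype.equivFinOfCardEq hcard).symm.injective⟩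

section Embeddings

variable {L : Type*} [Field L] [CharZero L] {φ : Fin 3 → (L →ₐ[ℚ] ℂ)}

theorem linearIndependent_embeddings (hφ : Function.Injective φ) :
    LinearIndependent ℂ fun i => (φ i).toLinearMap :=
  (linearIndependent_toLinearMap ℚ L ℂ).comp φ hφ

/-- Dedekind's independence of the embeddings. -/
theorem eq_of_sum_embeddings (hφ : Function.Injective φ) {u v : Fin 3 → ℂ}
    (e : ∀ x, ∑ i, u i * φ i x = ∑ i, v i * φ i x) : u = v := by
  have := Fintype.linearIndependent_iff.1 (linearIndependent_embeddings hφ) (u - v) (by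
    ext x
    simpa [sub_mul, sub_eq_zero] using e x)
  exact sub_eq_zero.1 (funext this)

theorem eq_of_sum_sum_embeddings (hφ : Function.Injective φ) {u v : Fin 3 → Fin 3 → ℂ}
    (e : ∀ x y, ∑ i, ∑ j, u i j * (φ i x * φ j y) = ∑ i, ∑ j, v i j * (φ i x * φ j y)) :
    u = v := by
  funext i
  refine eq_of_sum_embeddings hφ fun y => ?_
  have : (fun i => ∑ j, u i j * φ j y) = fun i => ∑ j, v i j * φ j y := by
    refine eq_of_sum_embeddings hφ fun x => ?_
    simp only [Finset.sum_mul]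
    convert e x y using 3 <;> ring
  exact congrFun this i

/-- The coordinates of `φ k ∘ T` in the basis of embeddings of the space of `ℚ`-linear maps
`L → ℂ`. -/
theorem exists_coords_end (hdeg : Module.finrank ℚ L = 3) (hφ : Function.Injective φ) (k : Fin 3) :
    ∃ C : Fin 3 → (Module.End ℚ L →ₗ[ℚ] ℂ), ∀ T x, φ k (T x) = ∑ i, C i T * φ i x := by
  have hfin : FiniteDimensional ℚ L := FiniteDimensional.of_finrank_pos (by omega)
  have hcard : Fintype.card (Fin 3) = Module.finrank ℂ (L →ₗ[ℚ] ℂ) := by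
    rw [Module.finrank_linearMap_self, hdeg, Fintype.card_fin]
  set Φ := basisOfLinearIndependentOfCardEqFinrank (linearIndependent_embeddings hφ) hcard with hΦ
  refine ⟨fun i => ((Φ.coord i).restrictScalars ℚ).comp
    ((φ k).toLinearMap.compRight ℚ), fun T x => ?_⟩
  have := congrArg (fun f : L →ₗ[ℚ] ℂ => f x) (Φ.sum_repr ((φ k).toLinearMap.comp T))
  simpa [hΦ] using this.symm

theorem eq_zero_of_sum_coords_end (hdeg : Module.finrank ℚ L = 3) {k : Fin 3}
    {C : Fin 3 → (Module.End ℚ L →ₗ[ℚ] ℂ)} (hC : ∀ T x, φ k (T x) = ∑ i, C i T * φ i x)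
    {u : Fin 3 → ℂ} (hu : ∀ T, ∑ i, u i * C i T = 0) : u = 0 := by
  have hfin : FiniteDimensional ℚ L := FiniteDimensional.of_finrank_pos (by omega)
  set B := Module.finBasisOfFinrankEq ℚ L hdeg
  -- the maps `B.coord m • 1` have linearly independent coordinates
  let V : Matrix (Fin 3) (Fin 3) ℂ := fun i m => φ i (B m)
  let M : Matrix (Fin 3) (Fin 3) ℂ := fun m i => C i ((B.coord m).smulRight 1)
  have hMV : M * V = 1 := by
    ext m m'
    rw [Matrix.mul_apply, ← hC]
    simp [Matrix.one_apply, Finsupp.single_apply, eq_comm]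
  have hM : M.mulVec u = 0 := by
    ext m
    simpa [Matrix.mulVec, dotProduct, mul_comm] using hu ((B.coord m).smulRight 1)
  calc u = (V * M).mulVec u := by rw [mul_eq_one_comm.1 hMV, Matrix.one_mulVec]
    _ = 0 := by rw [← Matrix.mulVec_mulVec, hM, Matrix.mulVec_zero]

end Embeddings

section Combinatorics

/-- A family of orthogonal idempotents with sum `1` in `ℂ ^ 3` is given by a map of indices. -/
theorem exists_index_map {P : Fin 3 → Fin 3 → ℂ}
    (hmul : ∀ i i' j, P i j * P i' j = if i = i' then P i j else 0) (hsum : ∀ j, ∑ i, P i j = 1) :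
    ∃ π : Fin 3 → Fin 3, ∀ i j, P i j = if π j = i then 1 else 0 := by
  have h1 : ∀ j, ∃ i, P i j ≠ 0 := fun j => by
    by_contra! h0
    simpa [h0] using hsum j
  choose π hπ using h1
  refine ⟨π, fun i j => ?_⟩
  split_ifs with h
  · subst h
    have := hmul (π j) (π j) j
    rw [if_pos rfl] at this
    exact mul_left_cancel₀ (hπ j) (by rw [this, mul_one])
  · have := hmul (π j) i j
    rw [if_neg h] at this
    exact (mul_eq_zero.1 this).resolve_left (hπ j)

/-- The only group law on `{0, 1, 2}` with identity `0` is addition modulo `3`. -/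
theorem eq_add_of_latin {g : Fin 3 → Fin 3 → Fin 3} (h0 : ∀ k, g 0 k = k) (h0' : ∀ j, g j 0 = j)
    (hsurj : ∀ k i, ∃ j, g j k = i) (hassoc : ∀ j l k, g l (g j k) = g (g l j) k) (j k : Fin 3) :
    g j k = k + j := by
  have key : ∀ p q r s : Fin 3, (∀ k i, ∃ j, ![![0, 1, 2], ![1, p, q], ![2, r, s]] j k = i) →
      (∀ j l k, ![![0, 1, 2], ![1, p, q], ![2, r, s]] l
          (![![0, 1, 2], ![1, p, q], ![2, r, s]] j k) =
        ![![0, 1, 2], ![1, p, q], ![2, r, s]]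
          (![![0, 1, 2], ![1, p, q], ![2, r, s]] l j) k) →
      ∀ j k : Fin 3, ![![0, 1, 2], ![1, p, q], ![2, r, s]] j k = k + j := by decide +kernel
  have hg : g = ![![0, 1, 2], ![1, g 1 1, g 1 2], ![2, g 2 1, g 2 2]] := by
    funext j k
    fin_cases j <;> fin_cases k <;> simp [h0, h0']
  have := key (g 1 1) (g 1 2) (g 2 1) (g 2 2)
  rw [← hg] at this
  exact this hsurj hassoc j k

end Combinatorics

section Action

variable {L : Type*} [Field L] [CharZero L] {φ : Fin 3 → (L →ₐ[ℚ] ℂ)}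
  {H : Type*} [Ring H] [HopfAlgebra ℚ H] [Module H L] [IsScalarTower ℚ H L]

theorem finrank_of_isHopfGaloisStructure (hdeg : Module.finrank ℚ L = 3)
    (hH : IsHopfGaloisStructure ℚ H L) : Module.finrank ℚ H = 3 := by
  have hfin : FiniteDimensional ℚ L := FiniteDimensional.of_finrank_pos (by omega)
  have := (LinearEquiv.ofBijective _ hH.bijective).finrank_eq
  rw [Module.finrank_tensorProduct, Module.finrank_linearMap, hdeg] at this
  omega

theorem eq_of_smul_eq (hH : IsHopfGaloisStructure ℚ H L) {h h' : H}
    (e : ∀ x : L, h • x = h' • x) : h = h' := by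
  have h1 : (1 : L) ⊗ₜ[ℚ] h = 1 ⊗ₜ h' := hH.bijective.1 (by
    ext x
    simp only [hopfGaloisMap_tmul, e])
  exact Algebra.TensorProduct.includeRight_injective (R := ℚ) (A := L) (B := H)
    (algebraMap ℚ L).injective h1

theorem smul_mul_eq_sum (hH : IsHopfGaloisStructure ℚ H L) {h : H} {ι : Type*}
    (R : Coalgebra.Repr ℚ h ι) (x y : L) :
    h • (x * y) = ∑ s ∈ R.index, (R.left s • x) * (R.right s • y) := by
  rw [hH.smul_mul, ← R.eq]
  simp [orbitMap]

/-- The matrix of the action of `h` in terms of the embeddings. -/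
theorem exists_coords_action (hdeg : Module.finrank ℚ L = 3) (hφ : Function.Injective φ)
    (hH : IsHopfGaloisStructure ℚ H L) :
    ∃ c : Fin 3 → Fin 3 → (H →ₗ[ℚ] ℂ), (∀ k h x, φ k (h • x) = ∑ i, c k i h * φ i x) ∧
      ∀ k (u : Fin 3 → ℂ), (∀ h, ∑ i, u i * c k i h = 0) → u = 0 := by
  choose C hC using exists_coords_end (L := L) hdeg hφ
  refine ⟨fun k i => (C k i).comp (Algebra.lsmul ℚ ℚ L : H →ₐ[ℚ] Module.End ℚ L).toLinearMap,
    fun k h x => ?_, fun k u hu => ?_⟩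
  · simpa using hC k (Algebra.lsmul ℚ ℚ L h) x
  · refine eq_zero_of_sum_coords_end hdeg (hC k) fun T => ?_
    have hmul : ∀ (x : L) (T : Module.End ℚ L) i,
        C k i (LinearMap.mulLeft ℚ x * T) = φ k x * C k i T := fun x T => by
      refine congrFun (eq_of_sum_embeddings (φ := φ) hφ (u := fun i => C k i _)
        (v := fun i => φ k x * C k i T) fun y => ?_)
      rw [← hC]
      simp only [Module.End.mul_apply, LinearMap.mulLeft_apply, map_mul, hC k T y, Finset.mul_sum,
        mul_assoc]
    obtain ⟨t, rfl⟩ := hH.bijective.2 T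
    induction t using TensorProduct.induction_on with
    | zero => simp
    | add t t' ht ht' => simp only [map_add, mul_add, Finset.sum_add_distrib, ht, ht', add_zero]
    | tmul x h =>
      have e : hopfGaloisMap ℚ H L (x ⊗ₜ h) =
          LinearMap.mulLeft ℚ x * (Algebra.lsmul ℚ ℚ L h : Module.End ℚ L) := by
        ext y; simp [hopfGaloisMap_tmul]
      have := hu h
      simp only [LinearMap.comp_apply, AlgHom.toLinearMap_apply] at this
      simp only [e, hmul, mul_left_comm _ (φ k x), ← Finset.mul_sum, this, mul_zero]

/-- The functionals in each row of the matrix of the action are orthogonal idempotents for the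
convolution product. -/
theorem sum_coords_repr (hφ : Function.Injective φ) (hH : IsHopfGaloisStructure ℚ H L)
    {c : Fin 3 → Fin 3 → (H →ₗ[ℚ] ℂ)} (hc : ∀ k h x, φ k (h • x) = ∑ i, c k i h * φ i x)
    {h : H} {ι : Type*} (R : Coalgebra.Repr ℚ h ι) (k i j : Fin 3) :
    ∑ s ∈ R.index, c k i (R.left s) * c k j (R.right s) = if i = j then c k i h else 0 := by
  refine congrFun (congrFun (eq_of_sum_sum_embeddings (φ := φ) hφ
    (u := fun i j => ∑ s ∈ R.index, c k i (R.left s) * c k j (R.right s))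
    (v := fun i j => if i = j then c k i h else 0) fun x y => ?_) i) j
  have e := hc k h (x * y)
  rw [smul_mul_eq_sum hH R] at e
  simp only [map_sum, map_mul, hc, Finset.sum_mul_sum] at e
  simp only [ite_mul, zero_mul, Finset.sum_ite_eq, Finset.mem_univ, if_true]
  rw [← e, Finset.sum_comm (s := R.index)]
  refine Finset.sum_congr rfl fun i _ => ?_
  rw [Finset.sum_comm (s := R.index)]
  refine Finset.sum_congr rfl fun j _ => ?_
  rw [Finset.sum_mul]
  exact Finset.sum_congr rfl fun s _ => by ring

/-- The rows of the matrix of the action are permutations of each other: they are made of the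
primitive idempotents of the convolution algebra of functionals `H → ℂ`. -/
theorem exists_index_action (hdeg : Module.finrank ℚ L = 3) (hφ : Function.Injective φ)
    (hH : IsHopfGaloisStructure ℚ H L) :
    ∃ (c : Fin 3 → (H →ₗ[ℚ] ℂ)) (g : Fin 3 → Fin 3 → Fin 3),
      (∀ k h x, φ k (h • x) = ∑ j, c j h * φ (g j k) x) ∧
      (∀ u : Fin 3 → ℂ, (∀ h, ∑ i, u i * c i h = 0) → u = 0) ∧
      (∀ j, c j 1 = if j = 0 then 1 else 0) ∧ (∀ j, g j 0 = j) ∧ ∀ k i, ∃ j, g j k = i := by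
  have hfinH : FiniteDimensional ℚ H := hH.finite
  obtain ⟨c, hc, hind⟩ := exists_coords_action hdeg hφ hH
  have hli : LinearIndependent ℂ fun i => c 0 i := by
    refine Fintype.linearIndependent_iff.2 fun u hu => congrFun (hind 0 u fun h => ?_)
    simpa using congrArg (fun f : H →ₗ[ℚ] ℂ => f h) hu
  have hcard : Fintype.card (Fin 3) = Module.finrank ℂ (H →ₗ[ℚ] ℂ) := by
    rw [Module.finrank_linearMap_self, finrank_of_isHopfGaloisStructure hdeg hH, Fintype.card_fin]
  set Φ := basisOfLinearIndependentOfCardEqFinrank hli hcard with hΦ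
  have hP : ∀ k, ∃ P : Fin 3 → Fin 3 → ℂ, ∀ i h, c k i h = ∑ j, P i j * c 0 j h := fun k => by
    refine ⟨fun i j => Φ.repr (c k i) j, fun i h => ?_⟩
    have := congrArg (fun f : H →ₗ[ℚ] ℂ => f h) (Φ.sum_repr (c k i))
    simpa [hΦ] using this.symm
  have hε : ∀ k h, ∑ i, c k i h = algebraMap ℚ ℂ (Coalgebra.counit h) := fun k h => by
    have := hc k h 1
    rw [hH.smul_one] at this
    simpa using this.symm
  have hπ : ∀ k, ∃ π : Fin 3 → Fin 3, ∀ i h, c k i h = ∑ j, if π j = i then c 0 j h else 0 := by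
    intro k
    obtain ⟨P, hP⟩ := hP k
    obtain ⟨π, hπ⟩ := exists_index_map (P := P) (fun i i' j => by
      refine sub_eq_zero.1 (congrFun (hind 0 (fun j => P i j * P i' j - if i = i' then P i j else 0)
        fun h => ?_) j)
      let R := Coalgebra.Repr.arbitrary ℚ h
      have e := sum_coords_repr hφ hH hc R k i i'
      have e2 : ∑ s ∈ R.index, c k i (R.left s) * c k i' (R.right s) =
          ∑ j, P i j * P i' j * c 0 j h := by
        simp only [hP, Finset.sum_mul_sum]
        rw [Finset.sum_comm]
        refine Finset.sum_congr rfl fun j _ => ?_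
        rw [Finset.sum_comm]
        have : ∀ l, ∑ s ∈ R.index, P i j * c 0 j (R.left s) * (P i' l * c 0 l (R.right s)) =
            P i j * P i' l * if j = l then c 0 j h else 0 := fun l => by
          rw [← sum_coords_repr hφ hH hc R 0 j l, Finset.mul_sum]
          exact Finset.sum_congr rfl fun s _ => by ring
        simp only [this]
        simp
      rw [e2] at e
      simp only [sub_mul, Finset.sum_sub_distrib, e, hP]
      split_ifs <;> simp) (fun j => by
      refine sub_eq_zero.1 (congrFun (hind 0 (fun j => ∑ i, P i j - 1) fun h => ?_) j)
      have e := (hε k h).trans (hε 0 h).symm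
      simp only [hP] at e
      rw [Finset.sum_comm] at e
      simp only [sub_mul, one_mul, Finset.sum_sub_distrib, Finset.sum_mul, e, sub_self])
    exact ⟨π, fun i h => by simp [hP, hπ, ite_mul]⟩
  choose π hπ using hπ
  have h1 : ∀ k i, c k i 1 = if i = k then 1 else 0 := fun k i => by
    refine congrFun (eq_of_sum_embeddings (φ := φ) hφ (u := fun i => c k i 1)
      (v := fun i => if i = k then 1 else 0) fun x => ?_) i
    rw [← hc]
    simp
  refine ⟨c 0, fun j k => π k j, fun k h x => ?_, hind 0, h1 0, fun j => ?_, fun k i => ?_⟩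
  · simp only [hc, hπ k, Finset.sum_mul, ite_mul, zero_mul]
    rw [Finset.sum_comm]
    simp
  · have := hind 0 (fun l => (if π 0 l = j then 1 else 0) - if l = j then 1 else 0) fun h => by
      have := hπ 0 j h
      simp only [sub_mul, Finset.sum_sub_distrib, ite_mul, one_mul, zero_mul, ← this]
      simp
    have := congrFun this j
    by_contra hne
    simp [hne] at this
  · by_contra! hne
    have := hind k (fun l => if l = i then 1 else 0) fun h => by
      simp [hπ k, hne]
    simpa using congrFun this i

/-- After extension of scalars to `ℂ` every Hopf-Galois structure on a cubic field acts through the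
cyclic group of order three: the matrix of the action of `h` in terms of the embeddings is
circulant. -/
theorem exists_circulant_action (hdeg : Module.finrank ℚ L = 3) (hφ : Function.Injective φ)
    (hH : IsHopfGaloisStructure ℚ H L) (h : H) :
    ∃ c : Fin 3 → ℂ, ∀ k x, φ k (h • x) = ∑ j, c j * φ (k + j) x := by
  obtain ⟨c, g, hc, hind, h1, hg0, hsurj⟩ := exists_index_action hdeg hφ hH
  have hg1 : ∀ k, g 0 k = k := fun k => hφ <| AlgHom.ext fun x => by
    have := hc k 1 x
    simp only [h1, one_smul] at this
    simpa using this.symm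
  have hmul : ∀ (h h' : H) m, c m (h * h') = ∑ j, ∑ l, if g l j = m then c j h * c l h' else 0 := by
    intro h h' m
    refine congrFun (eq_of_sum_embeddings (φ := φ) hφ (u := fun m => c m (h * h'))
      (v := fun m => ∑ j, ∑ l, if g l j = m then c j h * c l h' else 0) fun x => ?_) m
    have e := hc 0 (h * h') x
    simp only [mul_smul, hc, hg0, Finset.mul_sum] at e
    rw [← e]
    symm
    simp only [Finset.sum_mul, ite_mul, zero_mul]
    rw [Finset.sum_comm]
    refine Finset.sum_congr rfl fun j _ => ?_
    rw [Finset.sum_comm]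
    refine Finset.sum_congr rfl fun l _ => ?_
    simp [mul_assoc]
  have hassoc : ∀ j l k, g l (g j k) = g (g l j) k := by
    intro j l k
    refine hφ <| AlgHom.ext fun x => sub_eq_zero.1 ?_
    set D : Fin 3 → Fin 3 → ℂ := fun j l => φ (g l (g j k)) x - φ (g (g l j) k) x with hD
    have e : ∀ h h', ∑ j, ∑ l, D j l * (c j h * c l h') = 0 := fun h h' => by
      have e := hc k (h * h') x
      simp only [mul_smul, hc, hmul, Finset.mul_sum, Finset.sum_mul, ite_mul, zero_mul] at e
      have e2 : ∑ m, ∑ j, ∑ l, (if g l j = m then c j h * c l h' * φ (g m k) x else 0) =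
          ∑ j, ∑ l, c j h * c l h' * φ (g (g l j) k) x := by
        rw [Finset.sum_comm]
        refine Finset.sum_congr rfl fun j _ => ?_
        rw [Finset.sum_comm]
        simp
      rw [e2] at e
      have e3 : ∑ j, ∑ l, D j l * (c j h * c l h') =
          ∑ j, ∑ l, c j h * (c l h' * φ (g l (g j k)) x) -
            ∑ j, ∑ l, c j h * c l h' * φ (g (g l j) k) x := by
        simp only [← Finset.sum_sub_distrib]
        exact Finset.sum_congr rfl fun j _ => Finset.sum_congr rfl fun l _ => by simp only [hD]; ring
      rw [e3, e, sub_self]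
    have e2 : ∀ h', (fun j => ∑ l, D j l * c l h') = 0 := fun h' => hind _ fun h => by
      rw [← e h h']
      simp only [Finset.sum_mul]
      exact Finset.sum_congr rfl fun j _ => Finset.sum_congr rfl fun l _ => by ring
    exact congrFun (hind (D j) fun h' => congrFun (e2 h') j) l
  refine ⟨fun j => c j h, fun k x => ?_⟩
  simp only [hc k h x, eq_add_of_latin hg1 hg0 hsurj hassoc]

end Action

/-! ### The image of the Hopf algebra and free modules over the associated order -/

/-- `h` acts on `L = ℚ(α)` as `x + y t + z w`, where `t` is the trace and `w` is the `ℚ`-linear map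
`√Δ (σ - σ⁻¹)` in terms of a `3`-cycle `σ` of the conjugates of `α`; the values of `w` at
`1, α, α ^ 2` are written out. -/
structure HasActionCoords {L H : Type*} [Field L] [CharZero L] [Ring H] [Module H L] (a b : ℤ) (α : L)
    (h : H) (x y z : ℚ) : Prop where
  one : h • (1 : L) = x + 3 * y
  root : h • α = x * α + z * (6 * a * α ^ 2 + 9 * b * α - 4 * a ^ 2)
  root_sq : h • (α ^ 2) = x * α ^ 2 + 2 * a * y + z * (-9 * b * α ^ 2 - 2 * a ^ 2 * α + 6 * a * b)

theorem HasActionCoords.add {L H : Type*} [Field L] [CharZero L] [Ring H] [Module H L] {a b : ℤ}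
    {α : L} {h h' : H} {x y z x' y' z' : ℚ} (hc : HasActionCoords a b α h x y z)
    (hc' : HasActionCoords a b α h' x' y' z') :
    HasActionCoords a b α (h + h') (x + x') (y + y') (z + z') := by
  constructor
  · rw [add_smul, hc.one, hc'.one]; push_cast; ring
  · rw [add_smul, hc.root, hc'.root]; push_cast; ring
  · rw [add_smul, hc.root_sq, hc'.root_sq]; push_cast; ring

theorem HasActionCoords.zsmul {L H : Type*} [Field L] [CharZero L] [Ring H] [Module H L] {a b : ℤ}
    {α : L} {h : H} {x y z : ℚ} (hc : HasActionCoords a b α h x y z) (n : ℤ) :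
    HasActionCoords a b α (n • h) (n * x) (n * y) (n * z) := by
  constructor
  · rw [smul_assoc, hc.one, zsmul_eq_mul]; push_cast; ring
  · rw [smul_assoc, hc.root, zsmul_eq_mul]; push_cast; ring
  · rw [smul_assoc, hc.root_sq, zsmul_eq_mul]; push_cast; ring

section Action

variable {L : Type*} [Field L] [CharZero L] {a b : ℤ} {α : L}
  {H : Type*} [Ring H] [HopfAlgebra ℚ H] [Module H L] [IsScalarTower ℚ H L]

theorem smul_ratCast_mul (h : H) (q : ℚ) (v : L) : h • ((q : L) * v) = q * (h • v) := by
  have := smul_algebra_smul_comm q h v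
  rwa [Algebra.smul_def, Algebra.smul_def, eq_ratCast] at this

/-- `ℚ`-linearity of the action in the coordinates with respect to `1, α, α ^ 2`. -/
theorem smul_span (h : H) (p q r : ℚ) :
    h • ((p : L) + q * α + r * α ^ 2) = p * (h • (1 : L)) + q * (h • α) + r * (h • α ^ 2) := by
  rw [smul_add, smul_add, smul_ratCast_mul, smul_ratCast_mul, ← smul_ratCast_mul h p, mul_one]

theorem CubicRoot.vieta (hα : CubicRoot a b α) {φ : Fin 3 → (L →ₐ[ℚ] ℂ)}
    (hφ : Function.Injective φ) :
    φ 0 α + φ 1 α + φ 2 α = 0 ∧ φ 0 α * φ 1 α + φ 0 α * φ 2 α + φ 1 α * φ 2 α = -a ∧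
      φ 0 α * φ 1 α * φ 2 α = -b := by
  have hne : ∀ i j, i ≠ j → φ i α - φ j α ≠ 0 := fun i j hij e => hij <| hφ <| AlgHom.ext fun v => by
    obtain ⟨p, q, r, rfl⟩ := hα.span v
    simp [sub_eq_zero.1 e]
  have hr : ∀ i, (φ i α) ^ 3 = a * φ i α - b := fun i => by
    have := congrArg (φ i) hα.root
    simpa using this
  have h01 : (φ 0 α) ^ 2 + φ 0 α * φ 1 α + (φ 1 α) ^ 2 - a = 0 :=
    mul_left_cancel₀ (hne 0 1 (by decide)) (by linear_combination hr 0 - hr 1)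
  have h02 : (φ 0 α) ^ 2 + φ 0 α * φ 2 α + (φ 2 α) ^ 2 - a = 0 :=
    mul_left_cancel₀ (hne 0 2 (by decide)) (by linear_combination hr 0 - hr 2)
  have hs : φ 0 α + φ 1 α + φ 2 α = 0 :=
    mul_left_cancel₀ (hne 1 2 (by decide)) (by linear_combination h01 - h02)
  have h2 : φ 0 α * φ 1 α + φ 0 α * φ 2 α + φ 1 α * φ 2 α = -a := by
    linear_combination -h01 + (φ 0 α + φ 1 α) * hs
  exact ⟨hs, h2, by linear_combination φ 0 α * h2 - (φ 0 α) ^ 2 * hs + hr 0⟩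

/-- The conjugates of `w α` and `w (α ^ 2)`, with `√Δ = (r₁ - r₀) (r₁ - r₂) (r₂ - r₀)` in terms of
the roots. -/
theorem CubicRoot.map_diff (hα : CubicRoot a b α) {φ : Fin 3 → (L →ₐ[ℚ] ℂ)}
    (hφ : Function.Injective φ) : ∃ δ : ℂ, ∀ k,
      φ k (6 * a * α ^ 2 + 9 * b * α - 4 * a ^ 2) = δ * (φ (k + 1) α - φ (k + 2) α) ∧
      φ k (-9 * b * α ^ 2 - 2 * a ^ 2 * α + 6 * a * b) =
        δ * (φ (k + 1) (α ^ 2) - φ (k + 2) (α ^ 2)) := by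
  obtain ⟨h1, h2, h3⟩ := hα.vieta hφ
  refine ⟨(φ 1 α - φ 0 α) * (φ 1 α - φ 2 α) * (φ 2 α - φ 0 α), fun k => ?_⟩
  set r := φ 0 α with hr
  set s := φ 1 α with hs
  set t := φ 2 α with ht
  have et : t = -r - s := by linear_combination h1
  have ea : (a : ℂ) = -(r * s + r * t + s * t) := by linear_combination h2
  have eb : (b : ℂ) = -(r * s * t) := by linear_combination h3
  fin_cases k
  all_goals
    simp [map_ofNat, ← hr, ← hs, ← ht, ea, eb, et]
    constructor <;> ring

theorem HasActionCoords.exists_coords (hα : CubicRoot a b α) (hdeg : Module.finrank ℚ L = 3)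
    (hH : IsHopfGaloisStructure ℚ H L) (h : H) : ∃ x y z : ℚ, HasActionCoords a b α h x y z := by
  obtain ⟨φ, hφ⟩ := exists_fin_embeddings hdeg
  obtain ⟨c, hc⟩ := exists_circulant_action hdeg hφ hH h
  obtain ⟨hs, h2, -⟩ := hα.vieta hφ
  obtain ⟨δ, hδ⟩ := hα.map_diff hφ
  simp only [Fin.sum_univ_three] at hc
  obtain ⟨κ, hκ⟩ : ∃ κ : ℚ, h • (1 : L) = κ := ⟨_, by rw [hH.smul_one, eq_ratCast]⟩
  obtain ⟨τ₀, τ₁, τ₂, hτ⟩ := hα.span (h • α)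
  obtain ⟨ρ₀, ρ₁, ρ₂, hρ⟩ := hα.span (h • α ^ 2)
  have hc0 : c 0 + c 1 + c 2 = κ := by
    have := hc 0 1
    rw [hκ] at this
    simpa using this.symm
  have hsq : (φ 0 α) ^ 2 + (φ 1 α) ^ 2 + (φ 2 α) ^ 2 = 2 * a := by
    linear_combination (φ 0 α + φ 1 α + φ 2 α) * hs - 2 * h2
  -- `h` commutes with the trace
  have t1 : 3 * τ₀ + 2 * a * τ₂ = 0 := by
    have e0 := hc 0 α
    have e1 := hc 1 α
    have e2 := hc 2 α
    rw [hτ] at e0 e1 e2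
    simp at e0 e1 e2
    have : (3 * τ₀ + 2 * a * τ₂ : ℂ) = 0 := by
      linear_combination e0 + e1 + e2 + (c 0 + c 1 + c 2 - τ₁) * hs - τ₂ * hsq
    exact_mod_cast this
  have t2 : 3 * ρ₀ + 2 * a * ρ₂ = 2 * a * κ := by
    have e0 := hc 0 (α ^ 2)
    have e1 := hc 1 (α ^ 2)
    have e2 := hc 2 (α ^ 2)
    rw [hρ] at e0 e1 e2
    simp at e0 e1 e2
    have : (3 * ρ₀ + 2 * a * ρ₂ : ℂ) = 2 * a * κ := by
      linear_combination e0 + e1 + e2 + (c 0 + c 1 + c 2 - ρ₂) * hsq - ρ₁ * hs + 2 * a * hc0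
    exact_mod_cast this
  -- `h` commutes with `w`
  set w₁ : L := 6 * a * α ^ 2 + 9 * b * α - 4 * a ^ 2 with hw₁
  set w₂ : L := -9 * b * α ^ 2 - 2 * a ^ 2 * α + 6 * a * b with hw₂
  have e1 : h • w₁ = τ₁ * w₁ + τ₂ * w₂ := (φ 0).injective (by
    change φ 0 _ = φ 0 _
    have e1 := hc 1 α
    have e2 := hc 2 α
    rw [hτ] at e1 e2
    rw [hc 0 w₁]
    simp only [map_add, map_mul, map_ratCast, (hδ _).1, (hδ _).2]
    simp at e1 e2 ⊢
    linear_combination δ * (e2 - e1))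
  have e2 : h • w₂ = ρ₁ * w₁ + ρ₂ * w₂ := (φ 0).injective (by
    change φ 0 _ = φ 0 _
    have e1 := hc 1 (α ^ 2)
    have e2 := hc 2 (α ^ 2)
    rw [hρ] at e1 e2
    rw [hc 0 w₂]
    simp only [map_add, map_mul, map_ratCast, (hδ _).1, (hδ _).2]
    simp at e1 e2 ⊢
    linear_combination δ * (e2 - e1))
  have e1' : h • w₁ = (-4 * a ^ 2 : ℚ) * κ + (9 * b : ℚ) * (τ₀ + τ₁ * α + τ₂ * α ^ 2) +
      (6 * a : ℚ) * (ρ₀ + ρ₁ * α + ρ₂ * α ^ 2) := by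
    rw [← hτ, ← hρ, ← hκ, ← smul_span]
    congr 1
    push_cast
    ring
  have e2' : h • w₂ = (6 * a * b : ℚ) * κ + (-2 * a ^ 2 : ℚ) * (τ₀ + τ₁ * α + τ₂ * α ^ 2) +
      (-9 * b : ℚ) * (ρ₀ + ρ₁ * α + ρ₂ * α ^ 2) := by
    rw [← hτ, ← hρ, ← hκ, ← smul_span]
    congr 1
    push_cast
    ring
  obtain ⟨-, a1, a2⟩ := hα.ext_coords
    (p := -4 * a ^ 2 * τ₁ + 6 * a * b * τ₂) (q := 9 * b * τ₁ - 2 * a ^ 2 * τ₂)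
    (r := 6 * a * τ₁ - 9 * b * τ₂)
    (p' := -4 * a ^ 2 * κ + 9 * b * τ₀ + 6 * a * ρ₀) (q' := 9 * b * τ₁ + 6 * a * ρ₁)
    (r' := 9 * b * τ₂ + 6 * a * ρ₂) (by
      push_cast at e1' ⊢
      linear_combination e1' - e1)
  obtain ⟨-, b1, b2⟩ := hα.ext_coords
    (p := -4 * a ^ 2 * ρ₁ + 6 * a * b * ρ₂) (q := 9 * b * ρ₁ - 2 * a ^ 2 * ρ₂)
    (r := 6 * a * ρ₁ - 9 * b * ρ₂)
    (p' := 6 * a * b * κ - 2 * a ^ 2 * τ₀ - 9 * b * ρ₀) (q' := -2 * a ^ 2 * τ₁ - 9 * b * ρ₁)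
    (r' := -2 * a ^ 2 * τ₂ - 9 * b * ρ₂) (by
      push_cast at e2' ⊢
      linear_combination e2' - e2)
  have hb : (b : ℚ) ≠ 0 := by exact_mod_cast hα.b_ne_zero
  -- in `x + y t + z w` the diagonal entries at `α` and `α ^ 2` are `x + 9 b z` and `x - 9 b z`
  obtain ⟨z, hz⟩ : ∃ z : ℚ, 18 * b * z = τ₁ - ρ₂ := ⟨(τ₁ - ρ₂) / (18 * b), by field_simp⟩
  have hτ₂ : τ₂ = 6 * a * z := mul_left_cancel₀ (mul_ne_zero (by norm_num : (18 : ℚ) ≠ 0) hb) (by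
    linear_combination -a2 - 6 * a * hz)
  have hρ₁ : ρ₁ = -2 * a ^ 2 * z :=
    mul_left_cancel₀ (mul_ne_zero (by norm_num : (18 : ℚ) ≠ 0) hb) (by
      linear_combination b1 + 2 * a ^ 2 * hz)
  have hτ₀ : τ₀ = -4 * a ^ 2 * z := by linear_combination t1 / 3 - 2 * a / 3 * hτ₂
  have hρ₂ : ρ₂ = τ₁ - 9 * b * z - 9 * b * z := by linear_combination hz
  have hρ₀ : ρ₀ = 2 * a * ((κ - (τ₁ - 9 * b * z)) / 3) + 6 * a * b * z := by
    linear_combination t2 / 3 - 2 * a / 3 * hρ₂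
  refine ⟨τ₁ - 9 * b * z, (κ - (τ₁ - 9 * b * z)) / 3, z, ?_, ?_, ?_⟩
  · rw [hκ]; push_cast; ring
  · rw [hτ, hτ₀, hτ₂]; push_cast; ring
  · rw [hρ, hρ₀, hρ₁, hρ₂]; push_cast; ring

theorem HasActionCoords.smul_span {h : H} {x y z : ℚ} (hc : HasActionCoords a b α h x y z)
    (p q r : ℚ) : h • ((p : L) + q * α + r * α ^ 2) =
      (p * (x + 3 * y) - 4 * a ^ 2 * z * q + r * (2 * a * y + 6 * a * b * z) : ℚ) +
      (q * (x + 9 * b * z) - 2 * a ^ 2 * z * r : ℚ) * α +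
      (6 * a * z * q + r * (x - 9 * b * z) : ℚ) * α ^ 2 := by
  rw [_root_.smul_span, hc.one, hc.root, hc.root_sq]
  push_cast
  ring

theorem HasActionCoords.eq (hα : CubicRoot a b α) (hH : IsHopfGaloisStructure ℚ H L) {h h' : H}
    {x y z : ℚ} (hc : HasActionCoords a b α h x y z) (hc' : HasActionCoords a b α h' x y z) :
    h = h' :=
  eq_of_smul_eq hH fun v => by
    obtain ⟨p, q, r, rfl⟩ := hα.span v
    rw [hc.smul_span, hc'.smul_span]

/-- Every combination of `1`, `t` and `w` comes from `H`, by comparing dimensions. -/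
theorem HasActionCoords.exists_element (hα : CubicRoot a b α) (hdeg : Module.finrank ℚ L = 3)
    (hH : IsHopfGaloisStructure ℚ H L) (x y z : ℚ) : ∃ h : H, HasActionCoords a b α h x y z := by
  have hfin : FiniteDimensional ℚ L := FiniteDimensional.of_finrank_pos (by omega)
  have hfinH : FiniteDimensional ℚ H := hH.finite
  let E : H →ₗ[ℚ] L × L × L :=
    (orbitMap ℚ H L 1).prod ((orbitMap ℚ H L α).prod (orbitMap ℚ H L (α ^ 2)))
  have hE : ∀ h, E h = (h • (1 : L), h • α, h • α ^ 2) := fun h => rfl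
  let G : ℚ × ℚ × ℚ →ₗ[ℚ] L × L × L :=
    { toFun := fun v => (v.1 + 3 * v.2.1,
        v.1 * α + v.2.2 * (6 * a * α ^ 2 + 9 * b * α - 4 * a ^ 2),
        v.1 * α ^ 2 + 2 * a * v.2.1 + v.2.2 * (-9 * b * α ^ 2 - 2 * a ^ 2 * α + 6 * a * b))
      map_add' := fun v v' => by
        simp only [Prod.fst_add, Prod.snd_add, Prod.mk_add_mk, Rat.cast_add]
        ring_nf
      map_smul' := fun q v => by
        simp only [Prod.smul_fst, Prod.smul_snd, smul_eq_mul, Rat.cast_mul, RingHom.id_apply,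
          Prod.smul_mk, Rat.smul_def]
        ring_nf }
  have hEG : ∀ h v, E h = G v ↔ HasActionCoords a b α h v.1 v.2.1 v.2.2 := fun h v =>
    ⟨fun e => by
      simp only [hE, G, LinearMap.coe_mk, AddHom.coe_mk, Prod.mk.injEq] at e
      exact ⟨e.1, e.2.1, e.2.2⟩, fun hc => by
      simp only [hE, G, LinearMap.coe_mk, AddHom.coe_mk, Prod.mk.injEq]
      exact ⟨hc.one, hc.root, hc.root_sq⟩⟩
  have hle : LinearMap.range E ≤ LinearMap.range G := by
    rintro _ ⟨h, rfl⟩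
    obtain ⟨x, y, z, hc⟩ := HasActionCoords.exists_coords hα hdeg hH h
    exact ⟨(x, y, z), ((hEG h (x, y, z)).2 hc).symm⟩
  have hinj : Function.Injective E := fun h h' e => by
    obtain ⟨x, y, z, hc⟩ := HasActionCoords.exists_coords hα hdeg hH h
    refine hc.eq hα hH ((hEG h' (x, y, z)).1 ?_)
    rw [← e]
    exact (hEG h (x, y, z)).2 hc
  have heq : LinearMap.range E = LinearMap.range G := by
    refine Submodule.eq_of_le_of_finrank_le hle ?_
    rw [LinearMap.finrank_range_of_inj hinj, finrank_of_isHopfGaloisStructure hdeg hH]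
    refine (LinearMap.finrank_range_le G).trans ?_
    simp
  obtain ⟨h, hh⟩ : G (x, y, z) ∈ LinearMap.range E := heq ▸ ⟨_, rfl⟩
  exact ⟨h, (hEG h (x, y, z)).1 hh⟩

end Action

section Free

variable {L : Type*} [Field L] [CharZero L] {a b : ℤ} {α : L}
  {H : Type*} [Ring H] [HopfAlgebra ℚ H] [Module H L] [IsScalarTower ℚ H L]

/-- Some nonzero multiple of `h` preserves the ring of integers, which is a finitely generated
group. -/
theorem exists_zsmul_mem_associatedOrder (hdeg : Module.finrank ℚ L = 3)
    (hα : CubicRoot a b α) (hO : integralClosure ℤ L = Algebra.adjoin ℤ {α}) (h : H) :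
    ∃ n : ℤ, n ≠ 0 ∧ n • h ∈ associatedOrder H L := by
  have hfin : FiniteDimensional ℚ L := FiniteDimensional.of_finrank_pos (by omega)
  classical
  obtain ⟨n, hn, hint⟩ := exists_integral_multiples ℤ ℚ (L := L)
    {h • (1 : L), h • α, h • α ^ 2}
  refine ⟨n, hn, fun v hv => ?_⟩
  rw [hO, hα.mem_adjoin_iff] at hv
  obtain ⟨p, q, r, rfl⟩ := hv
  have e := smul_span (α := α) h p q r
  simp only [Rat.cast_intCast] at e
  rw [smul_assoc, e, smul_add, smul_add, ← mul_smul_comm, ← mul_smul_comm, ← mul_smul_comm]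
  exact add_mem (add_mem (isIntegral_intCast_mul (hint _ (by simp)))
    (isIntegral_intCast_mul (hint _ (by simp)))) (isIntegral_intCast_mul (hint _ (by simp)))

/-- A free module of integers has rank one by comparison of dimensions over `ℚ`. -/
theorem free_iff_exists_generator (hdeg : Module.finrank ℚ L = 3) (hα : CubicRoot a b α)
    (hO : integralClosure ℤ L = Algebra.adjoin ℤ {α}) (hH : IsHopfGaloisStructure ℚ H L) :
    Module.Free (associatedOrder H L) (integersModule H L) ↔
      ∃ θ ∈ integralClosure ℤ L, ∀ v ∈ integralClosure ℤ L, ∃ h ∈ associatedOrder H L, h • θ = v := by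
  have hfin : FiniteDimensional ℚ L := FiniteDimensional.of_finrank_pos (by omega)
  have hfinH : FiniteDimensional ℚ H := hH.finite
  have hrank : Module.finrank ℚ H = Module.finrank ℚ L := by
    rw [finrank_of_isHopfGaloisStructure hdeg hH, hdeg]
  have hQ : ∀ (n : ℤ) (h : H), n • h = 0 → n = 0 ∨ h = 0 := fun n h e => by
    rw [← Int.cast_smul_eq_zsmul ℚ, smul_eq_zero] at e
    exact_mod_cast e
  constructor
  · intro hfree
    let B := Module.Free.chooseBasis (associatedOrder H L) (integersModule H L)
    have hsub : Subsingleton (Module.Free.ChooseBasisIndex (associatedOrder H L)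
        (integersModule H L)) := ⟨fun i j => by
      by_contra hij
      have hinj : Function.Injective (orbitMap ℚ H L (B i : L)) := by
        refine (injective_iff_map_eq_zero _).2 fun h e => ?_
        obtain ⟨n, hn, hA⟩ := exists_zsmul_mem_associatedOrder hdeg hα hO h
        have e0 : (⟨n • h, hA⟩ : associatedOrder H L) • B i = 0 := Subtype.ext (by
          change (n • h) • (B i : L) = 0
          have e' : h • (B i : L) = 0 := e
          rw [smul_assoc, e', smul_zero])
        have := congrArg (fun v => B.repr v i) e0
        simp only [map_smul, Module.Basis.repr_self, map_zero, Finsupp.smul_apply,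
          Finsupp.single_eq_same, smul_eq_mul, mul_one, Finsupp.zero_apply] at this
        exact (hQ n h (congrArg Subtype.val this)).resolve_left hn
      obtain ⟨h, hh⟩ := (LinearMap.injective_iff_surjective_of_finrank_eq_finrank hrank).1 hinj
        (B j : L)
      obtain ⟨n, hn, hA⟩ := exists_zsmul_mem_associatedOrder hdeg hα hO h
      have e0 : (⟨n • h, hA⟩ : associatedOrder H L) • B i = (n : associatedOrder H L) • B j :=
        Subtype.ext (by
          change (n • h) • (B i : L) = ((n : associatedOrder H L) : H) • (B j : L)
          have e' : h • (B i : L) = B j := hh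
          rw [smul_assoc, e']
          push_cast
          rw [Int.cast_smul_eq_zsmul])
      have := congrArg (fun v => B.repr v j) e0
      simp [hij] at this
      have h2 := congrArg Subtype.val this
      have h3 : n • (1 : H) = 0 := by simpa using h2.symm
      have hnt : Nontrivial H := Module.nontrivial_of_finrank_pos (R := ℚ) (by omega)
      exact hn ((hQ n 1 h3).resolve_right one_ne_zero)⟩
    have hne : Nonempty (Module.Free.ChooseBasisIndex (associatedOrder H L)
        (integersModule H L)) := by
      by_contra hempty
      rw [not_nonempty_iff] at hempty
      have h0 : (⟨1, one_mem (integralClosure ℤ L)⟩ : integersModule H L) = 0 :=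
        B.repr.injective (Subsingleton.elim _ _)
      exact one_ne_zero (congrArg Subtype.val h0)
    obtain ⟨i⟩ := hne
    refine ⟨B i, (B i).2, fun v hv => ?_⟩
    refine ⟨B.repr ⟨v, hv⟩ i, (B.repr ⟨v, hv⟩ i).2, ?_⟩
    have e : B.repr ⟨v, hv⟩ i • B i = ⟨v, hv⟩ := B.repr.injective (by
      ext j
      rw [Subsingleton.elim j i]
      simp)
    exact congrArg Subtype.val e
  · rintro ⟨θ, hθ, hgen⟩
    have hsurj : Function.Surjective (orbitMap ℚ H L θ) := fun v => by
      obtain ⟨n, hn, hint⟩ := exists_integral_multiples ℤ ℚ (L := L) {v}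
      obtain ⟨h, -, hh⟩ := hgen _ (hint v (by simp))
      refine ⟨(n⁻¹ : ℚ) • h, ?_⟩
      change ((n⁻¹ : ℚ) • h) • θ = v
      rw [smul_assoc, hh, ← Int.cast_smul_eq_zsmul ℚ, smul_smul,
        inv_mul_cancel₀ (by exact_mod_cast hn), one_smul]
    have hinj := (LinearMap.injective_iff_surjective_of_finrank_eq_finrank hrank).2 hsurj
    let f : associatedOrder H L →ₗ[associatedOrder H L] integersModule H L :=
      LinearMap.toSpanSingleton _ _ ⟨θ, hθ⟩
    have hf : ∀ k, (f k : L) = (k : H) • θ := fun k => rfl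
    refine Module.Free.of_equiv (LinearEquiv.ofBijective f ⟨fun k k' e => ?_, fun v => ?_⟩)
    · refine Subtype.ext (hinj ?_)
      change (k : H) • θ = (k' : H) • θ
      rw [← hf, ← hf, e]
    · obtain ⟨h, hA, hh⟩ := hgen v v.2
      exact ⟨⟨h, hA⟩, Subtype.ext hh⟩

end Free

/-! ### Bases of the associated order and the Pell-type equation -/

section Generator

variable {L : Type*} [Field L] [CharZero L] {a b : ℤ} {α : L}

theorem CubicRoot.coords_int (hα : CubicRoot a b α)
    (hO : integralClosure ℤ L = Algebra.adjoin ℤ {α}) {p q r : ℚ} :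
    (p : L) + q * α + r * α ^ 2 ∈ integralClosure ℤ L ↔
      (∃ n : ℤ, p = n) ∧ (∃ n : ℤ, q = n) ∧ ∃ n : ℤ, r = n := by
  rw [hO, hα.mem_adjoin_iff]
  constructor
  · rintro ⟨u, v, w, e⟩
    obtain ⟨hp, hq, hr⟩ := hα.ext_coords (p' := u) (q' := v) (r' := w) (by exact_mod_cast e)
    exact ⟨⟨u, hp⟩, ⟨v, hq⟩, ⟨w, hr⟩⟩
  · rintro ⟨⟨u, rfl⟩, ⟨v, rfl⟩, ⟨w, rfl⟩⟩
    exact ⟨u, v, w, by simp⟩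

/-- An integral element generates the ring of integers over an order with `ℤ`-basis `h₀, h₁, h₂` if
and only if the determinant of the `hᵢ θ` is a unit. -/
theorem generator_iff_isUnit_det {L H : Type*} [Field L] [CharZero L] [Ring H] [Module H L]
    {a b : ℤ} {α : L} (hα : CubicRoot a b α)
    (hO : integralClosure ℤ L = Algebra.adjoin ℤ {α}) {θ : L} {h : Fin 3 → H}
    (hA : ∀ k, k ∈ associatedOrder H L ↔ ∃ n : Fin 3 → ℤ, k = ∑ i, n i • h i)
    {M : Matrix (Fin 3) (Fin 3) ℤ}
    (hM : ∀ i, h i • θ = M i 0 + M i 1 * α + M i 2 * α ^ 2) :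
    (∀ v ∈ integralClosure ℤ L, ∃ k ∈ associatedOrder H L, k • θ = v) ↔ IsUnit M.det := by
  have hsum : ∀ n : Fin 3 → ℤ, (∑ i, n i • h i) • θ = (Matrix.vecMul n M 0 : ℤ) + (Matrix.vecMul n M 1 : ℤ) * α +
      (Matrix.vecMul n M 2 : ℤ) * α ^ 2 := fun n => by
    rw [Fin.sum_univ_three, add_smul, add_smul, smul_assoc, smul_assoc, smul_assoc, hM, hM, hM]
    simp only [zsmul_eq_mul, Matrix.vecMul, dotProduct, Fin.sum_univ_three]
    push_cast
    ring
  constructor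
  · intro hgen
    have hpow : ∀ j : Fin 3, ∃ n : Fin 3 → ℤ, Matrix.vecMul n M = Pi.single j 1 := fun j => by
      obtain ⟨k, hk, e⟩ := hgen (α ^ (j : ℕ)) (hα.isIntegral.pow _)
      obtain ⟨n, rfl⟩ := (hA k).1 hk
      refine ⟨n, ?_⟩
      rw [hsum] at e
      obtain ⟨h0, h1, h2⟩ := hα.ext_coords (p := (Matrix.vecMul n M 0 : ℤ)) (q := (Matrix.vecMul n M 1 : ℤ))
        (r := (Matrix.vecMul n M 2 : ℤ)) (p' := (Pi.single j 1 : Fin 3 → ℚ) 0)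
        (q' := (Pi.single j 1 : Fin 3 → ℚ) 1) (r' := (Pi.single j 1 : Fin 3 → ℚ) 2) (by
          simp only [Rat.cast_intCast, e]
          fin_cases j <;> simp)
      funext i
      fin_cases j <;> fin_cases i <;> simp_all
    choose N hN using hpow
    have hNM : (Matrix.of N) * M = 1 := by
      ext i j
      rw [Matrix.mul_apply_eq_vecMul]
      change Matrix.vecMul (N i) M j = _
      rw [hN]
      simp [Matrix.one_apply, Pi.single_apply, eq_comm]
    exact Matrix.isUnit_det_of_left_inverse hNM
  · intro hdet v hv
    rw [hO, hα.mem_adjoin_iff] at hv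
    obtain ⟨p, q, r, rfl⟩ := hv
    refine ⟨_, (hA _).2 ⟨Matrix.vecMul ![p, q, r] M⁻¹, rfl⟩, ?_⟩
    rw [hsum, Matrix.vecMul_vecMul, Matrix.nonsing_inv_mul _ hdet, Matrix.vecMul_one]
    simp

variable {H : Type*} [Ring H] [HopfAlgebra ℚ H] [Module H L] [IsScalarTower ℚ H L]

theorem mem_associatedOrder_iff_smul_pow_mem (hα : CubicRoot a b α)
    (hO : integralClosure ℤ L = Algebra.adjoin ℤ {α}) {h : H} :
    h ∈ associatedOrder H L ↔ h • (1 : L) ∈ integralClosure ℤ L ∧ h • α ∈ integralClosure ℤ L ∧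
      h • (α ^ 2) ∈ integralClosure ℤ L := by
  constructor
  · intro hA
    exact ⟨hA _ (one_mem _), hA _ hα.isIntegral, hA _ (hα.isIntegral.pow 2)⟩
  · rintro ⟨h0, h1, h2⟩ v hv
    rw [hO, hα.mem_adjoin_iff] at hv
    obtain ⟨p, q, r, rfl⟩ := hv
    have e := smul_span (α := α) h p q r
    simp only [Rat.cast_intCast] at e
    rw [e]
    exact add_mem (add_mem (isIntegral_intCast_mul h0) (isIntegral_intCast_mul h1))
      (isIntegral_intCast_mul h2)

/-- The associated order consists of the `x + y t + z w` whose matrix in the basis `1, α, α ^ 2` is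
integral. -/
theorem HasActionCoords.mem_associatedOrder_iff (hα : CubicRoot a b α)
    (hO : integralClosure ℤ L = Algebra.adjoin ℤ {α}) {h : H} {x y z : ℚ}
    (hc : HasActionCoords a b α h x y z) :
    h ∈ associatedOrder H L ↔ (∃ n : ℤ, x + 3 * y = n) ∧
      ((∃ n : ℤ, -4 * a ^ 2 * z = n) ∧ (∃ n : ℤ, x + 9 * b * z = n) ∧ ∃ n : ℤ, 6 * a * z = n) ∧
      (∃ n : ℤ, 2 * a * y + 6 * a * b * z = n) ∧ (∃ n : ℤ, -2 * a ^ 2 * z = n) ∧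
        ∃ n : ℤ, x - 9 * b * z = n := by
  have e0 : h • (1 : L) = (x + 3 * y : ℚ) + (0 : ℚ) * α + (0 : ℚ) * α ^ 2 := by
    rw [hc.one]; push_cast; ring
  have e1 : h • α = (-4 * a ^ 2 * z : ℚ) + (x + 9 * b * z : ℚ) * α + (6 * a * z : ℚ) * α ^ 2 := by
    rw [hc.root]; push_cast; ring
  have e2 : h • α ^ 2 = (2 * a * y + 6 * a * b * z : ℚ) + (-2 * a ^ 2 * z : ℚ) * α +
      (x - 9 * b * z : ℚ) * α ^ 2 := by
    rw [hc.root_sq]; push_cast; ring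
  rw [mem_associatedOrder_iff_smul_pow_mem hα hO, e0, e1, e2, hα.coords_int hO, hα.coords_int hO,
    hα.coords_int hO]
  have h0 : ∃ n : ℤ, (0 : ℚ) = n := ⟨0, by simp⟩
  simp only [h0, and_true]

/-- Suppose that the associated order has the `ℤ`-basis `1, t / e, (e b (t - 3) + w) / N`. For
`θ = u₀ + u₁ α + u₂ α ^ 2` the determinant of the images of `θ` under this basis is the product of
the linear form `(3 u₀ + 2 a u₂) / e` and the binary quadratic form
`(6 a u₁ ^ 2 - 18 b u₁ u₂ + 2 a ^ 2 u₂ ^ 2) / N`, up to sign. -/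
theorem free_iff_exists_forms (hdeg : Module.finrank ℚ L = 3) (hα : CubicRoot a b α)
    (hO : integralClosure ℤ L = Algebra.adjoin ℤ {α}) (hH : IsHopfGaloisStructure ℚ H L)
    {e N : ℤ} (he : e ≠ 0) (hN : N ≠ 0) (he3 : e ∣ 3) (hea : e ∣ 2 * a)
    (h1 : N ∣ 9 * b - 3 * e * b) (h2 : N ∣ 2 * a ^ 2) (h3 : N ∣ 6 * a)
    (h4 : N ∣ 9 * b + 3 * e * b) (h5 : N ∣ 6 * a * b + 2 * e * a * b)
    (hΛ : ∀ y z : ℚ, (∃ n : ℤ, 3 * y - 9 * b * z = n) → (∃ n : ℤ, 3 * y + 9 * b * z = n) →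
      (∃ n : ℤ, 6 * a * z = n) → (∃ n : ℤ, 2 * a ^ 2 * z = n) →
      (∃ n : ℤ, 2 * a * y + 6 * a * b * z = n) →
      (∃ n : ℤ, N * z = n) ∧ ∃ n : ℤ, e * (y - e * b * z) = n) :
    Module.Free (associatedOrder H L) (integersModule H L) ↔ ∃ u₀ u₁ u₂ : ℤ,
      (3 * u₀ + 2 * a * u₂ = e ∨ 3 * u₀ + 2 * a * u₂ = -e) ∧
      (6 * a * u₁ ^ 2 - 18 * b * u₁ * u₂ + 2 * a ^ 2 * u₂ ^ 2 = N ∨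
        6 * a * u₁ ^ 2 - 18 * b * u₁ * u₂ + 2 * a ^ 2 * u₂ ^ 2 = -N) := by
  have heQ : (e : ℚ) ≠ 0 := by exact_mod_cast he
  have hNQ : (N : ℚ) ≠ 0 := by exact_mod_cast hN
  obtain ⟨k₀, c₀⟩ := HasActionCoords.exists_element hα hdeg hH 1 0 0
  obtain ⟨k₁, c₁⟩ := HasActionCoords.exists_element hα hdeg hH 0 (1 / e) 0
  obtain ⟨k₂, c₂⟩ := HasActionCoords.exists_element hα hdeg hH (-3 * e * b / N) (e * b / N) (1 / N)
  obtain ⟨d, hd⟩ := he3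
  obtain ⟨m, hm⟩ := hea
  obtain ⟨n₁, hn₁⟩ := h1
  obtain ⟨n₂, hn₂⟩ := h2
  obtain ⟨n₃, hn₃⟩ := h3
  obtain ⟨n₄, hn₄⟩ := h4
  obtain ⟨n₅, hn₅⟩ := h5
  have qd : (3 : ℚ) = e * d := by exact_mod_cast hd
  have qm : (2 * a : ℚ) = e * m := by exact_mod_cast hm
  have q₁ : (9 * b - 3 * e * b : ℚ) = N * n₁ := by exact_mod_cast hn₁
  have q₂ : (2 * a ^ 2 : ℚ) = N * n₂ := by exact_mod_cast hn₂
  have q₃ : (6 * a : ℚ) = N * n₃ := by exact_mod_cast hn₃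
  have q₄ : (9 * b + 3 * e * b : ℚ) = N * n₄ := by exact_mod_cast hn₄
  have q₅ : (6 * a * b + 2 * e * a * b : ℚ) = N * n₅ := by exact_mod_cast hn₅
  have hcomb : ∀ n : Fin 3 → ℤ, HasActionCoords a b α (∑ i, n i • ![k₀, k₁, k₂] i)
      (n 0 - 3 * e * b / N * n 2) (n 1 / e + e * b / N * n 2) (n 2 / N) := fun n => by
    have hs : ∑ i, n i • ![k₀, k₁, k₂] i = n 0 • k₀ + n 1 • k₁ + n 2 • k₂ := by
      rw [Fin.sum_univ_three]; rfl
    rw [hs]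
    convert ((c₀.zsmul (n 0)).add (c₁.zsmul (n 1))).add (c₂.zsmul (n 2)) using 1 <;> ring
  have hA : ∀ k, k ∈ associatedOrder H L ↔ ∃ n : Fin 3 → ℤ, k = ∑ i, n i • ![k₀, k₁, k₂] i := by
    intro k
    constructor
    · intro hk
      obtain ⟨x, y, z, hc⟩ := HasActionCoords.exists_coords hα hdeg hH k
      obtain ⟨⟨l₀, e₀⟩, ⟨-, ⟨l₂, e₂⟩, e₃⟩, e₄, ⟨l₅, e₅⟩, ⟨l₆, e₆⟩⟩ :=
        (hc.mem_associatedOrder_iff hα hO).1 hk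
      obtain ⟨⟨r, hr⟩, ⟨s, hs⟩⟩ := hΛ y z
        ⟨l₀ - l₂, by push_cast; linear_combination e₀ - e₂⟩
        ⟨l₀ - l₆, by push_cast; linear_combination e₀ - e₆⟩ e₃
        ⟨-l₅, by push_cast; linear_combination -e₅⟩ e₄
      have hz : z = r / N := by rw [eq_div_iff hNQ]; linear_combination hr
      have hy : y = s / e + e * b / N * r := by
        have : y - e * b * z = s / e := by rw [eq_div_iff heQ]; linear_combination hs
        rw [hz] at this
        linear_combination this
      refine ⟨![l₀ - d * s, s, r], hc.eq hα hH ?_⟩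
      convert hcomb ![l₀ - d * s, s, r] using 1
      · have hx : x = l₀ - 3 * y := by linear_combination e₀
        rw [hx, hy]
        simp
        field_simp
        linear_combination -(s * N : ℚ) * qd
      · simpa using hy
      · simpa using hz
    · rintro ⟨n, rfl⟩
      rw [(hcomb n).mem_associatedOrder_iff hα hO]
      refine ⟨⟨n 0 + d * n 1, ?_⟩, ⟨⟨-2 * n₂ * n 2, ?_⟩, ⟨n 0 + n₁ * n 2, ?_⟩, ⟨n₃ * n 2, ?_⟩⟩,
        ⟨m * n 1 + n₅ * n 2, ?_⟩, ⟨-n₂ * n 2, ?_⟩, ⟨n 0 - n₄ * n 2, ?_⟩⟩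
      all_goals
        push_cast
        field_simp
      · linear_combination (N * n 1 : ℚ) * qd
      · linear_combination -2 * (n 2 : ℚ) * q₂
      · linear_combination (n 2 : ℚ) * q₁
      · linear_combination (n 2 : ℚ) * q₃
      · linear_combination N * (n 1 : ℚ) * qm + e * (n 2 : ℚ) * q₅
      · linear_combination -(n 2 : ℚ) * q₂
      · linear_combination -(n 2 : ℚ) * q₄
  rw [free_iff_exists_generator hdeg hα hO hH]
  have hgen : ∀ u₀ u₁ u₂ : ℤ, (∀ v ∈ integralClosure ℤ L,
      ∃ k ∈ associatedOrder H L, k • ((u₀ : L) + u₁ * α + u₂ * α ^ 2) = v) ↔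
      IsUnit ((d * u₀ + m * u₂) *
        ((n₃ * u₁ - n₄ * u₂) * u₁ - (n₁ * u₁ - n₂ * u₂) * u₂)) := fun u₀ u₁ u₂ => by
    rw [generator_iff_isUnit_det hα hO hA (θ := (u₀ : L) + u₁ * α + u₂ * α ^ 2)
      (M := !![u₀, u₁, u₂; d * u₀ + m * u₂, 0, 0;
        -2 * n₂ * u₁ + n₅ * u₂, n₁ * u₁ - n₂ * u₂, n₃ * u₁ - n₄ * u₂])]
    · rw [← IsUnit.neg_iff, Matrix.det_fin_three]
      simp only [Matrix.of_apply, Matrix.cons_val]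
      ring_nf
    · have hint : ∀ {k : H} {x y z : ℚ} {p q r : ℤ}, HasActionCoords a b α k x y z →
          u₀ * (x + 3 * y) - 4 * a ^ 2 * z * u₁ + u₂ * (2 * a * y + 6 * a * b * z) = p →
          u₁ * (x + 9 * b * z) - 2 * a ^ 2 * z * u₂ = q →
          6 * a * z * u₁ + u₂ * (x - 9 * b * z) = r →
          k • ((u₀ : L) + u₁ * α + u₂ * α ^ 2) = p + q * α + r * α ^ 2 := by
        intro k x y z p q r hc hp hq hr
        have := hc.smul_span u₀ u₁ u₂
        rw [hp, hq, hr] at this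
        simpa only [Rat.cast_intCast] using this
      intro i
      fin_cases i
      · exact hint c₀ (p := u₀) (q := u₁) (r := u₂) (by simp) (by simp) (by simp)
      · refine hint c₁ (p := d * u₀ + m * u₂) (q := 0) (r := 0) ?_ (by simp) (by simp)
        push_cast
        field_simp
        linear_combination (u₀ : ℚ) * qd + u₂ * qm
      · refine hint c₂ (p := -2 * n₂ * u₁ + n₅ * u₂) (q := n₁ * u₁ - n₂ * u₂)
          (r := n₃ * u₁ - n₄ * u₂) ?_ ?_ ?_
        all_goals
          push_cast
          field_simp
        · linear_combination -2 * (u₁ : ℚ) * q₂ + u₂ * q₅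
        · linear_combination (u₁ : ℚ) * q₁ - u₂ * q₂
        · linear_combination (u₁ : ℚ) * q₃ - u₂ * q₄
  have hlin : ∀ u₀ u₂ : ℤ, IsUnit (d * u₀ + m * u₂) ↔
      (3 * u₀ + 2 * a * u₂ = e ∨ 3 * u₀ + 2 * a * u₂ = -e) := fun u₀ u₂ => by
    have e1 : 3 * u₀ + 2 * a * u₂ = e * (d * u₀ + m * u₂) := by linear_combination u₀ * hd + u₂ * hm
    rw [Int.isUnit_iff, e1, mul_eq_left₀ he, ← mul_neg_one e, mul_right_inj' he]
  have hquad : ∀ u₁ u₂ : ℤ, IsUnit ((n₃ * u₁ - n₄ * u₂) * u₁ - (n₁ * u₁ - n₂ * u₂) * u₂) ↔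
      (6 * a * u₁ ^ 2 - 18 * b * u₁ * u₂ + 2 * a ^ 2 * u₂ ^ 2 = N ∨
        6 * a * u₁ ^ 2 - 18 * b * u₁ * u₂ + 2 * a ^ 2 * u₂ ^ 2 = -N) := fun u₁ u₂ => by
    have e1 : 6 * a * u₁ ^ 2 - 18 * b * u₁ * u₂ + 2 * a ^ 2 * u₂ ^ 2 =
        N * ((n₃ * u₁ - n₄ * u₂) * u₁ - (n₁ * u₁ - n₂ * u₂) * u₂) := by
      linear_combination u₁ ^ 2 * hn₃ - u₁ * u₂ * (hn₄ + hn₁) + u₂ ^ 2 * hn₂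
    rw [Int.isUnit_iff, e1, mul_eq_left₀ hN, ← mul_neg_one N, mul_right_inj' hN]
  constructor
  · rintro ⟨θ, hθ, h⟩
    rw [hO, hα.mem_adjoin_iff] at hθ
    obtain ⟨u₀, u₁, u₂, rfl⟩ := hθ
    rw [hgen, IsUnit.mul_iff, hlin, hquad] at h
    exact ⟨u₀, u₁, u₂, h⟩
  · rintro ⟨u₀, u₁, u₂, h⟩
    refine ⟨u₀ + u₁ * α + u₂ * α ^ 2, ?_, ?_⟩
    · rw [hO, hα.mem_adjoin_iff]
      exact ⟨u₀, u₁, u₂, rfl⟩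
    · rw [hgen, IsUnit.mul_iff, hlin, hquad]
      exact h

end Generator

section Pell

/-- Completing the square: `(6 a u₁ - 9 b u₂) ^ 2 + 3 Δ u₂ ^ 2` is `6 a` times the quadratic form. -/
theorem exists_form_iff_exists_isPellSolution {a b m N : ℤ} (ha : a ≠ 0)
    (hm : m * (Int.gcd a b : ℤ) = 6 * N) (P : ℤ → Prop) :
    (∃ u₁ u₂ : ℤ, (6 * a * u₁ ^ 2 - 18 * b * u₁ * u₂ + 2 * a ^ 2 * u₂ ^ 2 = N ∨
        6 * a * u₁ ^ 2 - 18 * b * u₁ * u₂ + 2 * a ^ 2 * u₂ ^ 2 = -N) ∧ P u₂) ↔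
      ∃ x y : ℤ, IsPellSolution m a b x y ∧ P y := by
  have ha6 : 6 * a ≠ 0 := mul_ne_zero (by norm_num) ha
  have hRHS : m * a * (Int.gcd a b : ℤ) = 6 * a * N := by linear_combination a * hm
  have hsq : ∀ u₁ u₂ : ℤ, (6 * a * u₁ - 9 * b * u₂) ^ 2 + 3 * cubicDisc a b * u₂ ^ 2 =
      6 * a * (6 * a * u₁ ^ 2 - 18 * b * u₁ * u₂ + 2 * a ^ 2 * u₂ ^ 2) := fun u₁ u₂ => by
    rw [cubicDisc]; ring
  constructor
  · rintro ⟨u₁, u₂, h, hP⟩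
    refine ⟨6 * a * u₁ - 9 * b * u₂, u₂, ⟨?_, Or.inl ⟨u₁, by ring⟩⟩, hP⟩
    rw [hsq, hRHS]
    exact h.imp (fun h => by rw [h]) (fun h => by rw [h]; ring)
  · rintro ⟨x, y, ⟨hx, hdvd⟩, hP⟩
    obtain ⟨u, hu⟩ : ∃ u, (6 * a * u - 9 * b * y) ^ 2 = x ^ 2 := by
      rcases hdvd with ⟨u, hu⟩ | ⟨u, hu⟩
      · exact ⟨u, by rw [← hu]; ring⟩
      · exact ⟨u, by rw [← hu]; ring⟩
    refine ⟨u, y, ?_, hP⟩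
    rw [← hu, hsq, hRHS, ← mul_neg, mul_right_inj' ha6, mul_right_inj' ha6] at hx
    exact hx

end Pell

/-! ### The three cases -/

section Cases

/-- `a` and `b` divided by their greatest common divisor. -/
theorem exists_coprime_cofactors {a b : ℤ} (hb : b ≠ 0) : ∃ A B : ℤ,
    (Int.gcd a b : ℤ) ≠ 0 ∧ a = Int.gcd a b * A ∧ b = Int.gcd a b * B ∧ IsCoprime A B := by
  have hg : (Int.gcd a b : ℤ) ≠ 0 := by
    exact_mod_cast fun h => hb (Int.gcd_eq_zero_iff.1 h).2
  obtain ⟨A, hA⟩ := Int.gcd_dvd_left a b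
  obtain ⟨B, hB⟩ := Int.gcd_dvd_right a b
  refine ⟨A, B, hg, hA, hB, Int.gcdA a b, Int.gcdB a b, mul_left_cancel₀ hg ?_⟩
  linear_combination (-Int.gcdA a b) * hA - Int.gcdB a b * hB - Int.gcd_eq_gcd_ab a b

variable {L : Type*} [Field L] [CharZero L] {a b : ℤ} {α : L}
  {H : Type*} [Ring H] [HopfAlgebra ℚ H] [Module H L] [IsScalarTower ℚ H L]

/-- The associated order has the basis `1, t, (b (t - 3) + w) / (2 g)`. -/
theorem free_iff_of_not_three_dvd (hdeg : Module.finrank ℚ L = 3) (hα : CubicRoot a b α)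
    (hO : integralClosure ℤ L = Algebra.adjoin ℤ {α}) (hH : IsHopfGaloisStructure ℚ H L)
    (ha : ¬ (3 : ℤ) ∣ a) :
    Module.Free (associatedOrder H L) (integersModule H L) ↔
      ∃ x y : ℤ, IsPellSolution 12 a b x y ∧ ¬ (3 : ℤ) ∣ y := by
  obtain ⟨A, B, hg, hA, hB, hAB⟩ := exists_coprime_cofactors (a := a) hα.b_ne_zero
  have hpell := exists_form_iff_exists_isPellSolution (a := a) (b := b) (m := 12)
    (N := 2 * Int.gcd a b) (by rintro rfl; exact ha (dvd_zero 3)) (by ring) (fun y => ¬ (3 : ℤ) ∣ y)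
  rw [← hpell]
  clear hpell
  generalize (Int.gcd a b : ℤ) = g at *
  have hA3 : IsCoprime A 9 := by
    have h3 : IsCoprime (3 : ℤ) A := Int.prime_three.coprime_iff_not_dvd.2 fun h =>
      ha (hA ▸ h.mul_left g)
    exact h3.symm.pow_right (n := 2)
  obtain ⟨m, n, hmn⟩ := hA3.mul_right hAB
  obtain ⟨k, hk⟩ : ∃ k, a ^ 2 = 1 + 3 * k := by
    have h3 : a % 3 = 1 ∨ a % 3 = 2 := by omega
    rcases h3 with h | h
    · exact ⟨3 * (a / 3) ^ 2 + 2 * (a / 3), by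
        have : a = 3 * (a / 3) + 1 := by omega
        linear_combination (a + 3 * (a / 3) + 1) * this⟩
    · exact ⟨3 * (a / 3) ^ 2 + 4 * (a / 3) + 1, by
        have : a = 3 * (a / 3) + 2 := by omega
        linear_combination (a + 3 * (a / 3) + 2) * this⟩
  have qA : (a : ℚ) = g * A := by exact_mod_cast hA
  have qB : (b : ℚ) = g * B := by exact_mod_cast hB
  have qk : (a : ℚ) ^ 2 = 1 + 3 * k := by exact_mod_cast hk
  have qmn : (m * A + n * (9 * B) : ℚ) = 1 := by exact_mod_cast hmn
  rw [free_iff_exists_forms hdeg hα hO hH (e := 1) (N := 2 * g) one_ne_zero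
    (mul_ne_zero two_ne_zero hg) (one_dvd _) (one_dvd _)
    ⟨3 * B, by rw [hB]; ring⟩ ⟨A * a, by rw [hA]; ring⟩ ⟨3 * A, by rw [hA]; ring⟩
    ⟨6 * B, by rw [hB]; ring⟩ ⟨4 * A * b, by rw [hA]; ring⟩]
  · constructor
    · rintro ⟨u₀, u₁, u₂, hlin, hquad⟩
      refine ⟨u₁, u₂, hquad, ?_⟩
      rintro ⟨c, rfl⟩
      have h1 : (3 : ℤ) ∣ 1 := by
        rcases hlin with h | h
        · exact ⟨u₀ + 2 * a * c, by linear_combination -h⟩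
        · exact ⟨-(u₀ + 2 * a * c), by linear_combination h⟩
      omega
    · rintro ⟨u₁, u₂, hquad, hu⟩
      have h3 : ¬ (3 : ℤ) ∣ 2 * a * u₂ := fun h => by
        rcases Int.prime_three.dvd_or_dvd h with h | h
        · omega
        · exact hu h
      have h3' : 2 * a * u₂ % 3 = 1 ∨ 2 * a * u₂ % 3 = 2 := by omega
      rcases h3' with h | h
      · exact ⟨-(2 * a * u₂ / 3), u₁, u₂, Or.inl (by omega), hquad⟩
      · exact ⟨-(2 * a * u₂ / 3) - 1, u₁, u₂, Or.inr (by omega), hquad⟩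
  · rintro y z ⟨l₁, h₁⟩ ⟨l₂, h₂⟩ ⟨l₃, h₃⟩ ⟨l₄, h₄⟩ ⟨l₅, h₅⟩
    -- `2 a z` is an integer since `6 a z` and `2 a ^ 2 z` are, and `2 g z` since `2 a z` and `18 b z` are
    have hj : 2 * a * z = a * l₄ - k * l₃ := by
      linear_combination a * h₄ - k * h₃ - 2 * a * z * qk
    have hr : 2 * g * z = m * (a * l₄ - k * l₃) + n * (l₂ - l₁) := by
      linear_combination m * hj + n * (h₂ - h₁) - 2 * m * z * qA - 18 * n * z * qB - 2 * g * z * qmn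
    refine ⟨⟨m * (a * l₄ - k * l₃) + n * (l₂ - l₁), by push_cast; exact hr⟩,
      ⟨2 * a * (l₅ - 4 * b * (a * l₄ - k * l₃)) -
        (4 * k + 1) * (l₁ + 3 * B * (m * (a * l₄ - k * l₃) + n * (l₂ - l₁))), ?_⟩⟩
    -- `y - b z` is an integer since its multiples by the coprime integers `3` and `2 a` are
    have e3 : 3 * (y - b * z) = l₁ + 3 * B * (m * (a * l₄ - k * l₃) + n * (l₂ - l₁)) := by
      linear_combination h₁ + 3 * B * hr + 6 * z * qB
    have ea : 2 * a * (y - b * z) = l₅ - 4 * b * (a * l₄ - k * l₃) := by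
      linear_combination h₅ - 4 * b * hj
    push_cast
    rw [← e3, ← ea]
    linear_combination -4 * (y - b * z) * qk

/-- The associated order has the basis `1, t / 3, (3 b (t - 3) + w) / (6 g)`. -/
theorem free_iff_of_vp_three_eq_one (hdeg : Module.finrank ℚ L = 3) (hα : CubicRoot a b α)
    (hO : integralClosure ℤ L = Algebra.adjoin ℤ {α}) (hH : IsHopfGaloisStructure ℚ H L)
    (ha : vp 3 a = 1) (hb : vp 3 b = 1) :
    Module.Free (associatedOrder H L) (integersModule H L) ↔
      ∃ x y : ℤ, IsPellSolution 36 a b x y := by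
  obtain ⟨ha3, ha9⟩ := vp_eq_one_iff.1 ha
  obtain ⟨hb3, -⟩ := vp_eq_one_iff.1 hb
  push_cast at ha3 ha9 hb3
  obtain ⟨A, B, hg, hA, hB, hAB⟩ := exists_coprime_cofactors (a := a) hα.b_ne_zero
  have hpell := exists_form_iff_exists_isPellSolution (a := a) (b := b) (m := 36)
    (N := 6 * Int.gcd a b) (by rintro rfl; exact ha9 (dvd_zero _)) (by ring) (fun _ => True)
  simp only [and_true] at hpell
  rw [← hpell]
  clear hpell
  have hg3 : (3 : ℤ) ∣ Int.gcd a b := Int.dvd_coe_gcd ha3 hb3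
  generalize (Int.gcd a b : ℤ) = g at *
  have hA3 : IsCoprime A 3 := by
    refine (Int.prime_three.coprime_iff_not_dvd.2 fun h => ha9 ?_).symm
    rw [hA, show (9 : ℤ) = 3 * 3 by norm_num]
    exact mul_dvd_mul hg3 h
  obtain ⟨m, n, hmn⟩ := hA3.mul_right hAB
  have qA : (a : ℚ) = g * A := by exact_mod_cast hA
  have qB : (b : ℚ) = g * B := by exact_mod_cast hB
  have qmn : (m * A + n * (3 * B) : ℚ) = 1 := by exact_mod_cast hmn
  obtain ⟨c, hc⟩ := ha3
  rw [free_iff_exists_forms hdeg hα hO hH (e := 3) (N := 6 * g) (by norm_num)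
    (mul_ne_zero (by norm_num) hg) dvd_rfl ⟨2 * c, by rw [hc]; ring⟩
    ⟨0, by ring⟩ ⟨A * c, by linear_combination 2 * a * hc + 6 * c * hA⟩ ⟨A, by rw [hA]; ring⟩
    ⟨3 * B, by rw [hB]; ring⟩ ⟨2 * A * b, by rw [hA]; ring⟩]
  · constructor
    · rintro ⟨u₀, u₁, u₂, -, hquad⟩
      exact ⟨u₁, u₂, hquad⟩
    · rintro ⟨u₁, u₂, hquad⟩
      exact ⟨1 - 2 * c * u₂, u₁, u₂, Or.inl (by rw [hc]; ring), hquad⟩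
  · rintro y z ⟨l₁, h₁⟩ ⟨l₂, h₂⟩ ⟨l₃, h₃⟩ - -
    refine ⟨⟨m * l₃ + n * (l₂ - l₁), ?_⟩, ⟨l₁, by push_cast; linear_combination h₁⟩⟩
    push_cast
    linear_combination m * h₃ + n * (h₂ - h₁) - 6 * m * z * qA - 18 * n * z * qB - 6 * g * z * qmn

/-- The associated order has the basis `1, t / 3, (3 b (t - 3) + w) / (18 g)`. -/
theorem free_iff_of_vp_three_lt (hdeg : Module.finrank ℚ L = 3) (hα : CubicRoot a b α)
    (hO : integralClosure ℤ L = Algebra.adjoin ℤ {α}) (hH : IsHopfGaloisStructure ℚ H L)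
    (hab : vp 3 b < vp 3 a) :
    Module.Free (associatedOrder H L) (integersModule H L) ↔
      ∃ x y : ℤ, IsPellSolution 108 a b x y := by
  have hb0 := hα.b_ne_zero
  obtain ⟨A, B, hg, hA, hB, hAB⟩ := exists_coprime_cofactors (a := a) hb0
  have hA3 : (3 : ℤ) ∣ A := by
    have h3 : Prime ((3 : ℕ) : ℤ) := Int.prime_three
    have hlt : vp 3 (Int.gcd a b) + vp 3 B < vp 3 (Int.gcd a b) + vp 3 A := by
      have e1 : vp 3 a = vp 3 (Int.gcd a b) + vp 3 A := by
        conv_lhs => rw [hA]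
        exact emultiplicity_mul h3
      have e2 : vp 3 b = vp 3 (Int.gcd a b) + vp 3 B := by
        conv_lhs => rw [hB]
        exact emultiplicity_mul h3
      rwa [← e1, ← e2]
    have := lt_of_add_lt_add_left hlt
    exact_mod_cast one_le_vp_iff.1 (Order.one_le_iff_pos.2 (bot_le.trans_lt this))
  obtain ⟨C, rfl⟩ := hA3
  have hfree : Module.Free (associatedOrder H L) (integersModule H L) ↔ ∃ u₁ u₂ : ℤ,
      (6 * a * u₁ ^ 2 - 18 * b * u₁ * u₂ + 2 * a ^ 2 * u₂ ^ 2 = 18 * Int.gcd a b ∨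
        6 * a * u₁ ^ 2 - 18 * b * u₁ * u₂ + 2 * a ^ 2 * u₂ ^ 2 = -(18 * Int.gcd a b)) := by
    generalize (Int.gcd a b : ℤ) = g at *
    have hCB : IsCoprime C B := hAB.of_mul_left_right
    obtain ⟨m, n, hmn⟩ := hCB
    have qA : (a : ℚ) = g * (3 * C) := by exact_mod_cast hA
    have qB : (b : ℚ) = g * B := by exact_mod_cast hB
    have qmn : (m * C + n * B : ℚ) = 1 := by exact_mod_cast hmn
    rw [free_iff_exists_forms hdeg hα hO hH (e := 3) (N := 18 * g) (by norm_num)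
      (mul_ne_zero (by norm_num) hg) dvd_rfl ⟨2 * g * C, by rw [hA]; ring⟩
      ⟨0, by ring⟩ ⟨g * C ^ 2, by rw [hA]; ring⟩ ⟨C, by rw [hA]; ring⟩
      ⟨B, by rw [hB]; ring⟩ ⟨2 * C * b, by rw [hA]; ring⟩]
    · constructor
      · rintro ⟨u₀, u₁, u₂, -, hquad⟩
        exact ⟨u₁, u₂, hquad⟩
      · rintro ⟨u₁, u₂, hquad⟩
        exact ⟨1 - 2 * g * C * u₂, u₁, u₂, Or.inl (by rw [hA]; ring), hquad⟩
    · rintro y z ⟨l₁, h₁⟩ ⟨l₂, h₂⟩ ⟨l₃, h₃⟩ - -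
      refine ⟨⟨m * l₃ + n * (l₂ - l₁), ?_⟩, ⟨l₁, by push_cast; linear_combination h₁⟩⟩
      push_cast
      linear_combination m * h₃ + n * (h₂ - h₁) - 6 * m * z * qA - 18 * n * z * qB -
        18 * g * z * qmn
  rw [hfree]
  by_cases ha0 : a = 0
  · -- for a pure cubic field both sides hold: the quadratic form is `-18 b u₁ u₂`
    refine ⟨fun _ => ⟨0, 0, by simp [IsPellSolution, ha0]⟩, fun _ => ⟨1, 1, ?_⟩⟩
    rw [ha0, Int.gcd_zero_left]
    rcases Int.natAbs_eq b with h | h <;> omega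
  · have hpell := exists_form_iff_exists_isPellSolution (a := a) (b := b) (m := 108)
      (N := 18 * Int.gcd a b) ha0 (by ring) (fun _ => True)
    simpa only [and_true] using hpell

end Cases
theorem corollary6p6 {L : Type*} [Field L] [NumberField L] (hdeg : Module.finrank ℚ L = 3)
    (a b : ℤ) (α : L) (hroot : α ^ 3 - (a : L) * α + (b : L) = 0)
    (hgen : IntermediateField.adjoin ℚ {α} = ⊤) :
    -- the freeness criteria, for the Hopf-Galois structure `H` on `L`
    (∀ (H : Type*) [Ring H] [HopfAlgebra ℚ H] [Module H L] [IsScalarTower ℚ H L],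
      IsHopfGaloisStructure ℚ H L →
      (¬ (3 : ℤ) ∣ a → CondTwo a b → CondLarge a b →
        (Module.Free (associatedOrder H L) (integersModule H L) ↔
          ∃ x y : ℤ, IsPellSolution 12 a b x y ∧ ¬ (3 : ℤ) ∣ y)) ∧
      (vp 3 a = 1 → vp 3 b = 1 → CondTwo a b → CondLarge a b →
        (Module.Free (associatedOrder H L) (integersModule H L) ↔
          ∃ x y : ℤ, IsPellSolution 36 a b x y)) ∧
      (vp 3 b < vp 3 a → CondTwo a b → CondThree a b → CondLarge a b →
        (Module.Free (associatedOrder H L) (integersModule H L) ↔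
          ∃ x y : ℤ, IsPellSolution 108 a b x y))) ∧
    -- in each case the conditions are equivalent to `𝓞_L = ℤ[α]`
    (¬ (3 : ℤ) ∣ a →
      (CondTwo a b ∧ CondLarge a b ↔ integralClosure ℤ L = Algebra.adjoin ℤ {α})) ∧
    ((3 : ℤ) ∣ a → vp 3 a ≤ vp 3 b →
      (vp 3 a = 1 ∧ vp 3 b = 1 ∧ CondTwo a b ∧ CondLarge a b ↔
        integralClosure ℤ L = Algebra.adjoin ℤ {α})) ∧
    (vp 3 b < vp 3 a →
      (CondTwo a b ∧ CondThree a b ∧ CondLarge a b ↔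
        integralClosure ℤ L = Algebra.adjoin ℤ {α})) := by
  have hα := CubicRoot.of_adjoin_eq_top hdeg hroot hgen
  have hO₁ := integralClosure_eq_adjoin_iff_of_not_dvd hα hdeg
  have hO₂ := integralClosure_eq_adjoin_iff_of_vp_le hα hdeg
  have hO₃ := integralClosure_eq_adjoin_iff_of_vp_lt hα hdeg
  refine ⟨fun H _ _ _ _ hH => ⟨fun ha h2 hl => ?_, fun ha hb h2 hl => ?_, fun hab h2 h3 hl => ?_⟩,
    hO₁, hO₂, hO₃⟩
  · exact free_iff_of_not_three_dvd hdeg hα ((hO₁ ha).1 ⟨h2, hl⟩) hH ha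
  · refine free_iff_of_vp_three_eq_one hdeg hα ((hO₂ ?_ (by rw [ha, hb])).1 ⟨ha, hb, h2, hl⟩) hH ha hb
    exact_mod_cast one_le_vp_iff.1 ha.ge
  · exact free_iff_of_vp_three_lt hdeg hα ((hO₃ hab).1 ⟨h2, h3, hl⟩) hH hab
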